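/- Let $\mathfrak h$ be a finite-dimensional complex vector space, $W\subset GL(\mathfrak h)$ a finite subgroup, and $S$ the set of reflections in $W$, i.e. of the $s\in W$, $s\neq 1$, with $\operatorname{rk}(s-1)=1$. For $s\in S$ let $\alpha_s\in\mathfrak h^*$ be a generator of $\operatorname{Im}(s|_{\mathfrak h^*}-1)$, let $\alpha_s^\vee\in\mathfrak h$ be the generator of $\operatorname{Im}(s|_{\mathfrak h}-1)$ with $(\alpha_s,\alpha_s^\vee)=2$, and let $\lambda_s$ be the nontrivial eigenvalue of $s$ in $\mathfrak h^*$. Let $c:S\to\mathbb C$ be a $W$-invariant function. The rational Cherednik algebra $H_c(W,\mathfrak h)$ is the quotient of $\mathbb C W\ltimes T(\mathfrak h\oplus\mathfrak h^*)$ by the relations $[x,x']=0$, $[y,y']=0$, $[y,x]=(y,x)-\sum_{s\in S}c_s(y,\alpha_s)(x,\alpha_s^\vee)s$ for $x,x'\in\mathfrak h^*$, $y,y'\in\mathfrak h$; we write $x_\alpha$ and $y_a$ for its elements given by $\alpha\in\mathfrak h^*$ and $a\in\mathfrak h$. For $b\in\mathfrak h$, the completion $\widehat{H_c}(W,\mathfrak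 h)_b$ of $H_c(W,\mathfrak h)$ at the image of $b$ in $\mathfrak h/W$ is the algebra of linear operators on the algebra of regular functions on the formal neighborhood of the orbit $Wb$ in $\mathfrak h$ (the completion of $\mathbb C[\mathfrak h]$ at the ideal of $Wb$) generated by multiplications by these functions, the group $W$, and the Dunkl--Opdam operators $$D_a=\partial_a+\sum_{s\in S}\frac{2c_s}{1-\lambda_s}\frac{\alpha_s(a)}{\alpha_s}(s-1),\qquad a\in\mathfrak h .$$ There is a natural homomorphism $H_c(W,\mathfrak h)\to\widehat{H_c}(W,\mathfrak h)_b$, given by $w\mapsto w$ for $w\in W$, $x_\alpha\mapsto\alpha$, $y_a\mapsto D_a$; images of elements under it are denoted by the same letters. For finite groups $H\subset G$ and an algebra $A$ with a homomorphism from $H$ to its group of units, let $Z(G,H,A)=\operatorname{End}_A(P)$, where $P=\operatorname{Fun}_H(G,A)$ is the right $A$-module of functions $f:G\to A$ with $f(hg)=hf(g)$ for $h\in H$, $g\in G$. Let $b\in\mathfrak h$, let $W_b$ be its stabilizer in $W$, and let $c'$ be the restriction of $c$ to the set of reflections in $W_b$. Then the natural homomorphisms above exist for $H_c(W,\mathfrak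 h)$ at $b$ and for $H_{c'}(W_b,\mathfrak h)$ at $0$, and there is a unique isomorphism of $\mathbb C$-algebras $$\theta:\widehat{H_c}(W,\mathfrak h)_b\to Z\bigl(W,W_b,\widehat{H_{c'}}(W_b,\mathfrak h)_0\bigr)$$ such that for all $f\in P=\operatorname{Fun}_{W_b}(W,\widehat{H_{c'}}(W_b,\mathfrak h)_0)$ and $w\in W$: $$(\theta(u)f)(w)=f(wu)\quad(u\in W),$$ $$(\theta(x_\alpha)f)(w)=\bigl(x^{(b)}_{w\alpha}+(w\alpha,b)\bigr)f(w)\quad(\alpha\in\mathfrak h^*),$$ $$(\theta(y_a)f)(w)=y^{(b)}_{wa}f(w)+\sum_{s\in S:\,s\notin W_b}\frac{2c_s}{1-\lambda_s}\,\frac{\alpha_s(wa)}{x^{(b)}_{\alpha_s}+\alpha_s(b)}\,\bigl(f(sw)-f(w)\bigr)\quad(a\in\mathfrak h),$$ where $x^{(b)}_\alpha$, $y^{(b)}_a$ are the elements of $H_{c'}(W_b,\mathfrak h)$ corresponding to $\alpha$, $a$, and the fraction is understood as an element of $\mathbb C[[\mathfrak h]]$ (note that $\alpha_s(b)\ne0$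 for $s\notin W_b$). -/

import Mathlib

namespace Cherednik

noncomputable section

open Module

variable {V : Type*} [AddCommGroup V] [Module ℂ V]

/-- The action of `w ∈ GL(V)` on `V*`: `(w α)(v) = α (w⁻¹ v)`. -/
def dualAct (w : V ≃ₗ[ℂ] V) : Dual ℂ V →ₗ[ℂ] Dual ℂ V :=
  (w⁻¹ : V ≃ₗ[ℂ] V).toLinearMap.dualMap

/-- The set `S` of (complex) reflections in `W`: the `s ≠ 1` in `W` with `rk (s - 1) = 1`. -/
def reflections (W : Subgroup (V ≃ₗ[ℂ] V)) : Set (V ≃ₗ[ℂ] V) :=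
  {s | s ∈ W ∧ s ≠ 1 ∧ finrank ℂ (LinearMap.range (s.toLinearMap - LinearMap.id)) = 1}

/-- A choice, for every reflection `s ∈ W`, of a generator `α_s` of `Im (s - 1)` in `V*` and of the
generator `α_s^∨` of `Im (s - 1)` in `V` with `(α_s, α_s^∨) = 2`; `eig s` is the nontrivial
eigenvalue `λ_s` of `s` in `V*`, which is the eigenvalue of `s` on `α_s`. -/
structure Roots (W : Subgroup (V ≃ₗ[ℂ] V)) where
  root : reflections W → Dual ℂ V
  coroot : reflections W → V
  eig : reflections W → ℂ
  span_root : ∀ s : reflections W, Submodule.span ℂ {root s} =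
    LinearMap.range (dualAct (s : V ≃ₗ[ℂ] V) - LinearMap.id)
  span_coroot : ∀ s : reflections W, Submodule.span ℂ {coroot s} =
    LinearMap.range ((s : V ≃ₗ[ℂ] V).toLinearMap - LinearMap.id)
  pairing : ∀ s, root s (coroot s) = 2
  eig_spec : ∀ s : reflections W, dualAct (s : V ≃ₗ[ℂ] V) (root s) = eig s • root s

/-- `c : S → ℂ` is `W`-invariant, i.e. constant on `W`-conjugacy classes of reflections. -/
def IsInvariant {W : Subgroup (V ≃ₗ[ℂ] V)} (c : reflections W → ℂ) : Prop :=
  ∀ s t : reflections W, ∀ w ∈ W, w * (s : V ≃ₗ[ℂ] V) * w⁻¹ = t → c t = c s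

/-! ### Passing to a subgroup -/

lemma reflections_mono {W' W : Subgroup (V ≃ₗ[ℂ] V)} (h : W' ≤ W) :
    reflections W' ⊆ reflections W := fun _ hs => ⟨h hs.1, hs.2⟩

/-- The restriction of a function on the reflections of `W` to the reflections of `W'`. -/
def restrictParam {W' W : Subgroup (V ≃ₗ[ℂ] V)} (h : W' ≤ W) (c : reflections W → ℂ) :
    reflections W' → ℂ := fun s => c (Set.inclusion (reflections_mono h) s)

/-- The same `α_s`, `α_s^∨`, for the reflections of `W'` only. -/
def Roots.restrict {W' W : Subgroup (V ≃ₗ[ℂ] V)} (r : Roots W) (h : W' ≤ W) : Roots W' where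
  root s := r.root (Set.inclusion (reflections_mono h) s)
  coroot s := r.coroot (Set.inclusion (reflections_mono h) s)
  eig s := r.eig (Set.inclusion (reflections_mono h) s)
  span_root s := r.span_root (Set.inclusion (reflections_mono h) s)
  span_coroot s := r.span_coroot (Set.inclusion (reflections_mono h) s)
  pairing s := r.pairing (Set.inclusion (reflections_mono h) s)
  eig_spec s := r.eig_spec (Set.inclusion (reflections_mono h) s)

/-- The stabilizer `W_b` of `b` in `W`. -/
def pointStabilizer (W : Subgroup (V ≃ₗ[ℂ] V)) (b : V) : Subgroup (V ≃ₗ[ℂ] V) :=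
  W ⊓ MulAction.stabilizer (V ≃ₗ[ℂ] V) b

lemma pointStabilizer_le (W : Subgroup (V ≃ₗ[ℂ] V)) (b : V) : pointStabilizer W b ≤ W :=
  inf_le_left

/-! ### The rational Cherednik algebra `H_c(W, V)` -/

/-- Generators of the rational Cherednik algebra: `w ∈ W`, `x_α` for `α ∈ V*`, `y_a` for `a ∈ V`. -/
inductive Gen (W : Subgroup (V ≃ₗ[ℂ] V)) : Type _
  | grp (w : W)
  | x (α : Dual ℂ V)
  | y (a : V)

section Presentation

variable {W : Subgroup (V ≃ₗ[ℂ] V)}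

/-- The defining relations. The first eight families present `ℂ W ⋉ T(V ⊕ V*)`; the last three are
the relations `[x, x'] = 0`, `[y, y'] = 0` and
`[y, x] = (y, x) - ∑ s ∈ S, c_s (y, α_s) (x, α_s^∨) s`. -/
inductive Rel (r : Roots W) (c : reflections W → ℂ) :
    FreeAlgebra ℂ (Gen W) → FreeAlgebra ℂ (Gen W) → Prop
  | grp_one : Rel r c (FreeAlgebra.ι ℂ (Gen.grp 1)) 1
  | grp_mul (u v : W) : Rel r c (FreeAlgebra.ι ℂ (Gen.grp (u * v)))
      (FreeAlgebra.ι ℂ (Gen.grp u) * FreeAlgebra.ι ℂ (Gen.grp v))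
  | x_add (α β : Dual ℂ V) : Rel r c (FreeAlgebra.ι ℂ (Gen.x (α + β)))
      (FreeAlgebra.ι ℂ (Gen.x α) + FreeAlgebra.ι ℂ (Gen.x β))
  | x_smul (t : ℂ) (α : Dual ℂ V) : Rel r c (FreeAlgebra.ι ℂ (Gen.x (t • α)))
      (t • FreeAlgebra.ι ℂ (Gen.x α))
  | y_add (a a' : V) : Rel r c (FreeAlgebra.ι ℂ (Gen.y (a + a')))
      (FreeAlgebra.ι ℂ (Gen.y a) + FreeAlgebra.ι ℂ (Gen.y a'))
  | y_smul (t : ℂ) (a : V) : Rel r c (FreeAlgebra.ι ℂ (Gen.y (t • a)))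
      (t • FreeAlgebra.ι ℂ (Gen.y a))
  | grp_x (w : W) (α : Dual ℂ V) :
      Rel r c (FreeAlgebra.ι ℂ (Gen.grp w) * FreeAlgebra.ι ℂ (Gen.x α))
        (FreeAlgebra.ι ℂ (Gen.x (dualAct (w : V ≃ₗ[ℂ] V) α)) * FreeAlgebra.ι ℂ (Gen.grp w))
  | grp_y (w : W) (a : V) :
      Rel r c (FreeAlgebra.ι ℂ (Gen.grp w) * FreeAlgebra.ι ℂ (Gen.y a))
        (FreeAlgebra.ι ℂ (Gen.y ((w : V ≃ₗ[ℂ] V) a)) * FreeAlgebra.ι ℂ (Gen.grp w))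
  | x_comm (α β : Dual ℂ V) :
      Rel r c (FreeAlgebra.ι ℂ (Gen.x α) * FreeAlgebra.ι ℂ (Gen.x β))
        (FreeAlgebra.ι ℂ (Gen.x β) * FreeAlgebra.ι ℂ (Gen.x α))
  | y_comm (a a' : V) :
      Rel r c (FreeAlgebra.ι ℂ (Gen.y a) * FreeAlgebra.ι ℂ (Gen.y a'))
        (FreeAlgebra.ι ℂ (Gen.y a') * FreeAlgebra.ι ℂ (Gen.y a))
  | y_x (a : V) (α : Dual ℂ V) :
      Rel r c (FreeAlgebra.ι ℂ (Gen.y a) * FreeAlgebra.ι ℂ (Gen.x α) -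
          FreeAlgebra.ι ℂ (Gen.x α) * FreeAlgebra.ι ℂ (Gen.y a))
        (algebraMap ℂ _ (α a) - ∑ᶠ s : reflections W,
          (c s * r.root s a * α (r.coroot s)) • FreeAlgebra.ι ℂ (Gen.grp ⟨s, s.2.1⟩))

/-- The rational Cherednik algebra `H_c(W, V)`. -/
abbrev Alg (r : Roots W) (c : reflections W → ℂ) : Type _ := RingQuot (Rel r c)

variable (r : Roots W) (c : reflections W → ℂ)

/-- The element `w` of `H_c(W, V)`. -/
def Alg.grp (w : W) : Alg r c := RingQuot.mkAlgHom ℂ (Rel r c) (FreeAlgebra.ι ℂ (Gen.grp w))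

/-- The element `x_α` of `H_c(W, V)`. -/
def Alg.x (α : Dual ℂ V) : Alg r c := RingQuot.mkAlgHom ℂ (Rel r c) (FreeAlgebra.ι ℂ (Gen.x α))

/-- The element `y_a` of `H_c(W, V)`. -/
def Alg.y (a : V) : Alg r c := RingQuot.mkAlgHom ℂ (Rel r c) (FreeAlgebra.ι ℂ (Gen.y a))

end Presentation

/-! ### Polynomial functions on `V` and Dunkl operators -/

variable (V) in
/-- The algebra `ℂ[V] = S(V*)` of polynomial functions on `V`. -/
abbrev Poly : Type _ := SymmetricAlgebra ℂ (Dual ℂ V)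

/-- A linear form as a polynomial function. -/
abbrev lin (α : Dual ℂ V) : Poly V := SymmetricAlgebra.ι ℂ (Dual ℂ V) α

/-- Evaluation of polynomial functions at the point `p`. -/
def evalAt (p : V) : Poly V →ₐ[ℂ] ℂ := SymmetricAlgebra.lift (Dual.eval ℂ V p)

/-- The action of `w ∈ GL(V)` on polynomial functions: `(w F)(v) = F (w⁻¹ v)`. -/
def polyAct (w : V ≃ₗ[ℂ] V) : Poly V →ₐ[ℂ] Poly V :=
  SymmetricAlgebra.lift (SymmetricAlgebra.ι ℂ (Dual ℂ V) ∘ₗ dualAct w)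

/-- `F(v) ↦ F(v + ε a)`, with values in the dual numbers. -/
def infinitesimalShift (a : V) : Poly V →ₐ[ℂ] DualNumber (Poly V) :=
  SymmetricAlgebra.lift
    ((TrivSqZeroExt.inlAlgHom ℂ (Poly V) (Poly V)).toLinearMap ∘ₗ
        SymmetricAlgebra.ι ℂ (Dual ℂ V) +
      (TrivSqZeroExt.inrHom (Poly V) (Poly V)).restrictScalars ℂ ∘ₗ
        Algebra.linearMap ℂ (Poly V) ∘ₗ Dual.eval ℂ V a)

/-- The directional derivative `∂_a` on polynomial functions: the coefficient of `ε` in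
`F(v + ε a)`. -/
def deriv (a : V) : Poly V →ₗ[ℂ] Poly V :=
  (TrivSqZeroExt.sndHom (Poly V) (Poly V)).restrictScalars ℂ ∘ₗ
    (infinitesimalShift a).toLinearMap

lemma fst_infinitesimalShift (a : V) (F : Poly V) : (infinitesimalShift a F).fst = F := by
  have h : (TrivSqZeroExt.fstHom ℂ (Poly V) (Poly V)).comp (infinitesimalShift a) =
      AlgHom.id ℂ (Poly V) := by
    apply SymmetricAlgebra.algHom_ext
    ext α
    simp [infinitesimalShift]
  exact DFunLike.congr_fun h F

lemma deriv_lin (a : V) (α : Dual ℂ V) : deriv a (lin α) = algebraMap ℂ _ (α a) := by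
  simp [deriv, infinitesimalShift, Algebra.algebraMap_eq_smul_one]

lemma deriv_mul (a : V) (F G : Poly V) : deriv a (F * G) = deriv a F * G + F * deriv a G := by
  simp only [deriv, LinearMap.comp_apply, AlgHom.toLinearMap_apply, map_mul,
    LinearMap.restrictScalars_apply, TrivSqZeroExt.sndHom_apply, TrivSqZeroExt.snd_mul,
    fst_infinitesimalShift, smul_eq_mul, MulOpposite.smul_eq_mul_unop, MulOpposite.unop_op]
  ring

section Dunkl

variable {W : Subgroup (V ≃ₗ[ℂ] V)} (r : Roots W)

lemma root_ne_zero (s : reflections W) : r.root s ≠ 0 := by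
  intro h
  have := r.pairing s
  simp [h] at this

lemma lin_injective : Function.Injective (lin : Dual ℂ V → Poly V) := by
  intro α β h
  ext a
  have := congrArg (deriv a) h
  simpa [deriv_lin] using this

lemma lin_root_ne_zero (s : reflections W) : lin (r.root s) ≠ 0 := by
  intro h
  exact root_ne_zero r s (lin_injective (by simpa using h))

lemma mul_root_injective (s : reflections W) :
    Function.Injective (LinearMap.mulLeft ℂ (lin (r.root s))) := by
  intro F G h
  exact mul_left_cancel₀ (lin_root_ne_zero r s) h

lemma root_dvd (s : reflections W) (F : Poly V) :
    lin (r.root s) ∣ polyAct (s : V ≃ₗ[ℂ] V) F - F := by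
  induction F using SymmetricAlgebra.induction with
  | algebraMap t => simp
  | ι α =>
    have h : (dualAct (s : V ≃ₗ[ℂ] V) - LinearMap.id : Dual ℂ V →ₗ[ℂ] Dual ℂ V) α ∈ Submodule.span ℂ {r.root s} := by
      rw [r.span_root s]; exact ⟨α, rfl⟩
    obtain ⟨t, ht⟩ := Submodule.mem_span_singleton.1 h
    refine ⟨algebraMap ℂ _ t, ?_⟩
    have : polyAct (s : V ≃ₗ[ℂ] V) (lin α) - lin α =
        lin ((dualAct (s : V ≃ₗ[ℂ] V) - LinearMap.id : Dual ℂ V →ₗ[ℂ] Dual ℂ V) α) := by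
      simp [polyAct]
    rw [this, ← ht, lin, map_smul, Algebra.smul_def, mul_comm]
  | mul F G hF hG =>
    have : polyAct (s : V ≃ₗ[ℂ] V) (F * G) - F * G =
        (polyAct (s : V ≃ₗ[ℂ] V) F - F) * G +
          polyAct (s : V ≃ₗ[ℂ] V) F * (polyAct (s : V ≃ₗ[ℂ] V) G - G) := by
      rw [map_mul]; ring
    rw [this]
    exact dvd_add (hF.mul_right _) (hG.mul_left _)
  | add F G hF hG =>
    have : polyAct (s : V ≃ₗ[ℂ] V) (F + G) - (F + G) =
        (polyAct (s : V ≃ₗ[ℂ] V) F - F) + (polyAct (s : V ≃ₗ[ℂ] V) G - G) := by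
      rw [map_add]; ring
    rw [this]
    exact dvd_add hF hG

lemma root_act_sub_mem (s : reflections W) (F : Poly V) :
    ((polyAct (s : V ≃ₗ[ℂ] V)).toLinearMap - LinearMap.id : Poly V →ₗ[ℂ] Poly V) F ∈
      LinearMap.range (LinearMap.mulLeft ℂ (lin (r.root s))) := by
  obtain ⟨G, hG⟩ := root_dvd r s F
  exact ⟨G, hG.symm⟩

/-- The operator `F ↦ (s F - F) / α_s` on polynomial functions. -/
def divDiff (s : reflections W) : Poly V →ₗ[ℂ] Poly V :=
  (LinearEquiv.ofInjective _ (mul_root_injective r s)).symm.toLinearMap ∘ₗ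
    ((polyAct (s : V ≃ₗ[ℂ] V)).toLinearMap - LinearMap.id).codRestrict
      (LinearMap.range (LinearMap.mulLeft ℂ (lin (r.root s))))
      (root_act_sub_mem r s)

lemma root_mul_divDiff (s : reflections W) (F : Poly V) :
    lin (r.root s) * divDiff r s F = polyAct (s : V ≃ₗ[ℂ] V) F - F := by
  have h := LinearEquiv.apply_symm_apply (LinearEquiv.ofInjective _ (mul_root_injective r s))
    (((polyAct (s : V ≃ₗ[ℂ] V)).toLinearMap - LinearMap.id).codRestrict
      (LinearMap.range (LinearMap.mulLeft ℂ (lin (r.root s))))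
      (root_act_sub_mem r s) F)
  exact congrArg Subtype.val h

lemma divDiff_mul (s : reflections W) (F G : Poly V) :
    divDiff r s (F * G) = divDiff r s F * G + polyAct (s : V ≃ₗ[ℂ] V) F * divDiff r s G := by
  apply mul_left_cancel₀ (lin_root_ne_zero r s)
  rw [root_mul_divDiff, mul_add, ← mul_assoc, root_mul_divDiff, mul_left_comm, root_mul_divDiff,
    map_mul]
  ring

/-- The Dunkl-Opdam operator
`∂_a + ∑ s ∈ S, 2 c_s / (1 - λ_s) * (α_s(a) / α_s) (s - 1)` on polynomial functions. -/
def dunkl (c : reflections W → ℂ) (a : V) : Poly V →ₗ[ℂ] Poly V :=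
  deriv a + ∑ᶠ s : reflections W, (2 * c s / (1 - r.eig s) * r.root s a) • divDiff r s

end Dunkl

/-! ### Functions on the formal neighbourhood of an orbit -/

section Orbit

variable (W : Subgroup (V ≃ₗ[ℂ] V)) (b : V)

/-- The ideal of polynomial functions vanishing on the `W`-orbit of `b`. -/
def orbitIdeal : Ideal (Poly V) := ⨅ w : W, RingHom.ker (evalAt ((w : V ≃ₗ[ℂ] V) b))

/-- The algebra of regular functions on the formal neighbourhood in `V` of the `W`-orbit of `b`
(for `b = 0` it is `ℂ[[V]]`). -/
abbrev FormalFun : Type _ := AdicCompletion (orbitIdeal W b) (Poly V)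

lemma evalAt_polyAct (w : V ≃ₗ[ℂ] V) (p : V) (F : Poly V) :
    evalAt p (polyAct w F) = evalAt (w⁻¹ p) F := by
  have h : (evalAt p).comp (polyAct w) = evalAt (w⁻¹ p) := by
    apply SymmetricAlgebra.algHom_ext
    ext α
    simp [evalAt, polyAct, dualAct]
  exact DFunLike.congr_fun h F

lemma polyAct_mem (u : W) {k : ℕ} {F : Poly V} (hF : F ∈ orbitIdeal W b ^ k) :
    polyAct (u : V ≃ₗ[ℂ] V) F ∈ orbitIdeal W b ^ k := by
  have h : orbitIdeal W b ≤ (orbitIdeal W b).comap (polyAct (u : V ≃ₗ[ℂ] V)) := by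
    intro G hG
    simp only [orbitIdeal, Ideal.mem_comap, Submodule.mem_iInf, RingHom.mem_ker] at hG ⊢
    intro w
    rw [evalAt_polyAct]
    exact hG (u⁻¹ * w)
  exact (Ideal.le_comap_pow (polyAct (u : V ≃ₗ[ℂ] V)) k) (Ideal.pow_right_mono h k hF)

/-- The operators on polynomial functions that lower the order of vanishing on the orbit by at most
one. -/
def shiftOps : Submodule ℂ (Poly V →ₗ[ℂ] Poly V) where
  carrier := {D | ∀ k, ∀ F ∈ orbitIdeal W b ^ (k + 1), D F ∈ orbitIdeal W b ^ k}
  add_mem' hD hE k F hF := add_mem (hD k F hF) (hE k F hF)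
  zero_mem' _ _ _ := zero_mem _
  smul_mem' t _ hD k F hF := Submodule.smul_of_tower_mem _ t (hD k F hF)

lemma mem_shiftOps_of_twisted (D : Poly V →ₗ[ℂ] Poly V) (u : W)
    (h : ∀ F G, D (F * G) = D F * G + polyAct (u : V ≃ₗ[ℂ] V) F * D G) : D ∈ shiftOps W b := by
  intro k
  induction k with
  | zero => intro F _; simp
  | succ k ih =>
    intro F hF
    rw [pow_succ] at hF
    refine Submodule.mul_induction_on hF (fun G hG K hK => ?_) (fun G K hG hK => ?_)
    · rw [h]
      refine add_mem ?_ (Ideal.mul_mem_right _ _ (polyAct_mem W b u hG))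
      rw [pow_succ]
      exact Ideal.mul_mem_mul (ih G hG) hK
    · rw [map_add]; exact add_mem hG hK

lemma polyAct_one : polyAct (1 : V ≃ₗ[ℂ] V) = AlgHom.id ℂ (Poly V) := by
  apply SymmetricAlgebra.algHom_ext
  ext α
  have : dualAct (1 : V ≃ₗ[ℂ] V) α = α := by ext v; simp [dualAct]
  simp [polyAct, this]

lemma polyAct_mul (u v : V ≃ₗ[ℂ] V) : polyAct (u * v) = (polyAct u).comp (polyAct v) := by
  apply SymmetricAlgebra.algHom_ext
  ext α
  have : dualAct (u * v) α = dualAct u (dualAct v α) := by ext; simp [dualAct]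
  simp [polyAct, this]

lemma deriv_mem_shiftOps (a : V) : deriv a ∈ shiftOps W b :=
  mem_shiftOps_of_twisted W b _ 1 fun F G => by simp [deriv_mul, polyAct_one]

lemma polyAct_mem_shiftOps (u : W) : (polyAct (u : V ≃ₗ[ℂ] V)).toLinearMap ∈ shiftOps W b :=
  fun k _ hF => polyAct_mem W b u (Ideal.pow_le_pow_right (Nat.le_succ k) hF)

variable {W} in
lemma dunkl_mem_shiftOps (r : Roots W) (c : reflections W → ℂ) (a : V) :
    dunkl r c a ∈ shiftOps W b :=
  add_mem (deriv_mem_shiftOps W b a)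
    (finsum_induction (· ∈ shiftOps W b) (zero_mem _) (fun _ _ => add_mem)
      fun s : reflections W =>
      Submodule.smul_mem _ _ (mem_shiftOps_of_twisted W b _ ⟨s, s.2.1⟩ (divDiff_mul r s)))

variable {W b}

/-- The map `ℂ[V]/J^(k+1) → ℂ[V]/J^k` induced by an operator in `shiftOps`. -/
def extendAux (D : shiftOps W b) (k : ℕ) :
    (Poly V ⧸ (orbitIdeal W b ^ (k + 1) • ⊤ : Submodule (Poly V) (Poly V))) →ₗ[ℂ]
      (Poly V ⧸ (orbitIdeal W b ^ k • ⊤ : Submodule (Poly V) (Poly V))) :=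
  (Submodule.Quotient.restrictScalarsEquiv ℂ _).toLinearMap ∘ₗ
    Submodule.mapQ _ ((orbitIdeal W b ^ k • ⊤ : Submodule (Poly V) (Poly V)).restrictScalars ℂ)
      (D : Poly V →ₗ[ℂ] Poly V) (fun F hF => by
        have := D.2 k F (by simpa using hF)
        simpa using this) ∘ₗ
    (Submodule.Quotient.restrictScalarsEquiv ℂ _).symm.toLinearMap

lemma extendAux_mk (D : shiftOps W b) (k : ℕ) (F : Poly V) :
    extendAux D k (Submodule.Quotient.mk F) = Submodule.Quotient.mk (D.1 F) := rfl

lemma transitionMap_extendAux (D : shiftOps W b) {m n : ℕ} (hmn : m ≤ n)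
    (x : Poly V ⧸ (orbitIdeal W b ^ (n + 1) • ⊤ : Submodule (Poly V) (Poly V))) :
    AdicCompletion.transitionMap (orbitIdeal W b) (Poly V) hmn (extendAux D n x) =
      extendAux D m (AdicCompletion.transitionMap (orbitIdeal W b) (Poly V)
        (Nat.succ_le_succ hmn) x) := by
  obtain ⟨G, rfl⟩ := Submodule.Quotient.mk_surjective _ x
  rfl

/-- The continuous extension of an operator in `shiftOps` to the formal neighbourhood of the
orbit. -/
def extend (D : shiftOps W b) : Module.End ℂ (FormalFun W b) where
  toFun F := ⟨fun k => extendAux D k (F.val (k + 1)), fun {m n} hmn =>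
    (transitionMap_extendAux D hmn (F.val (n + 1))).trans
      (congrArg (extendAux D m) (F.2 (Nat.succ_le_succ hmn)))⟩
  map_add' F G := AdicCompletion.ext fun k =>
    map_add (extendAux D k) (F.val (k + 1)) (G.val (k + 1))
  map_smul' t F := AdicCompletion.ext fun k =>
    map_smul (extendAux D k) t (F.val (k + 1))

/-- `extend D` agrees with `D` on polynomial functions. -/
lemma extend_of (D : shiftOps W b) (F : Poly V) :
    extend D (AdicCompletion.of _ _ F) = AdicCompletion.of _ _ (D.1 F) := rfl

variable (W b)

lemma extend_one (h : (polyAct ((1 : W) : V ≃ₗ[ℂ] V)).toLinearMap ∈ shiftOps W b) :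
    extend ⟨_, h⟩ = 1 := by
  have key (k : ℕ)
      (x : Poly V ⧸ (orbitIdeal W b ^ (k + 1) • ⊤ : Submodule (Poly V) (Poly V))) :
      extendAux ⟨_, h⟩ k x =
        AdicCompletion.transitionMap (orbitIdeal W b) (Poly V) (Nat.le_succ k) x := by
    obtain ⟨G, rfl⟩ := Submodule.Quotient.mk_surjective _ x
    rw [extendAux_mk]
    exact congrArg Submodule.Quotient.mk (DFunLike.congr_fun polyAct_one G)
  exact LinearMap.ext fun F => AdicCompletion.ext fun k =>
    (key k (F.val (k + 1))).trans (F.2 (Nat.le_succ k))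

variable {W b} in
lemma extend_mul (D E DE : shiftOps W b) (h : DE.1 = D.1 ∘ₗ E.1) :
    extend DE = extend D * extend E := by
  have key (k : ℕ)
      (x : Poly V ⧸ (orbitIdeal W b ^ (k + 1 + 1) • ⊤ : Submodule (Poly V) (Poly V))) :
      extendAux DE k (AdicCompletion.transitionMap (orbitIdeal W b) (Poly V)
        (Nat.le_succ (k + 1)) x) = extendAux D k (extendAux E (k + 1) x) := by
    obtain ⟨G, rfl⟩ := Submodule.Quotient.mk_surjective _ x
    rw [extendAux_mk, extendAux_mk]
    exact congrArg Submodule.Quotient.mk (DFunLike.congr_fun h G)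
  exact LinearMap.ext fun F => AdicCompletion.ext fun k =>
    (congrArg (extendAux DE k) (F.2 (Nat.le_succ (k + 1)))).symm.trans
      (key k (F.val (k + 1 + 1)))

/-- The action of `W` on functions on the formal neighbourhood of the orbit. -/
def formalAct : W →* Module.End ℂ (FormalFun W b) where
  toFun u := extend ⟨_, polyAct_mem_shiftOps W b u⟩
  map_one' := extend_one W b _
  map_mul' u v := extend_mul _ _ _
    (congrArg AlgHom.toLinearMap (polyAct_mul (u : V ≃ₗ[ℂ] V) (v : V ≃ₗ[ℂ] V)))

end Orbit

/-! ### The completion of `H_c(W, V)` at the image of `b` in `V / W` -/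

section Completion

variable {W : Subgroup (V ≃ₗ[ℂ] V)} (r : Roots W) (c : reflections W → ℂ) (b : V)

/-- The completion of `H_c(W, V)` at the image of `b` in `V / W`: the algebra of linear operators
on the functions on the formal neighbourhood of the orbit `W b` generated by these functions
(acting by multiplication), the group `W` and the Dunkl-Opdam operators. -/
def completion : Subalgebra ℂ (Module.End ℂ (FormalFun W b)) :=
  Algebra.adjoin ℂ
    (Set.range (LinearMap.mulLeft ℂ (A := FormalFun W b)) ∪ Set.range (formalAct W b) ∪
      Set.range fun a => extend ⟨dunkl r c a, dunkl_mem_shiftOps b r c a⟩)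

/-- A function on the formal neighbourhood, as an element of the completed algebra. -/
def completion.func (φ : FormalFun W b) : completion r c b :=
  ⟨LinearMap.mulLeft ℂ φ, Algebra.subset_adjoin (Or.inl (Or.inl ⟨φ, rfl⟩))⟩

/-- The group `W` in the completed algebra. -/
def completion.grp : W →* completion r c b :=
  (formalAct W b).codRestrict (completion r c b)
    fun u => Algebra.subset_adjoin (Or.inl (Or.inr ⟨u, rfl⟩))

/-- The Dunkl-Opdam operator of `a`, as an element of the completed algebra. -/
def completion.dunklOp (a : V) : completion r c b :=
  ⟨extend ⟨dunkl r c a, dunkl_mem_shiftOps b r c a⟩, Algebra.subset_adjoin (Or.inr ⟨a, rfl⟩)⟩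

/-- A linear form, as a function on the formal neighbourhood of the orbit of `b`. -/
def formalLin (W : Subgroup (V ≃ₗ[ℂ] V)) (b : V) (α : Dual ℂ V) : FormalFun W b :=
  AdicCompletion.of (orbitIdeal W b) (Poly V) (lin α)

/-- `ι` is the natural homomorphism from `H_c(W, V)` to its completion at `b`: it sends `w` to `w`,
`x_α` to multiplication by `α` and `y_a` to the Dunkl-Opdam operator of `a`. -/
def IsNatural (ι : Alg r c →ₐ[ℂ] completion r c b) : Prop :=
  (∀ w, ι (Alg.grp r c w) = completion.grp r c b w) ∧
  (∀ α, ι (Alg.x r c α) = completion.func r c b (formalLin W b α)) ∧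
  ∀ a, ι (Alg.y r c a) = completion.dunklOp r c b a

end Completion

/-! ### The centralizer construction -/

section Centralizer

variable {G H A : Type*} [Group G] [Group H] [Ring A] [Algebra ℂ A]

/-- The right `A`-module `P = Fun_H(G, A)` of functions `f : G → A` with `f (h g) = h f (g)`, for
`i : H →* G` and `j : H →* A`. -/
def funH (i : H →* G) (j : H →* A) : Submodule Aᵐᵒᵖ (G → A) where
  carrier := {f | ∀ h g, f (i h * g) = j h * f g}
  add_mem' hf hf' h g := by simp [hf h g, hf' h g, mul_add]
  zero_mem' h g := by simp
  smul_mem' a f hf h g := by simp [hf h g, mul_assoc]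

/-- The centralizer algebra `Z(G, H, A) = End_A(P)` of the right `A`-module `P = Fun_H(G, A)`. -/
abbrev centralizerAlg (i : H →* G) (j : H →* A) : Type _ := Module.End Aᵐᵒᵖ (funH i j)

end Centralizer

section Local

variable {W : Subgroup (V ≃ₗ[ℂ] V)} (r : Roots W) (c : reflections W → ℂ) (b : V)

/-- The completion at `0` of `H_{c'}(W_b, V)`, with `c'` the restriction of `c` to `W_b`. -/
abbrev localCompletion : Subalgebra ℂ (Module.End ℂ (FormalFun (pointStabilizer W b) 0)) :=
  completion (r.restrict (pointStabilizer_le W b)) (restrictParam (pointStabilizer_le W b) c) 0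

/-- The algebra `Z(W, W_b, A)` for `A` the completion at `0` of `H_{c'}(W_b, V)`. -/
abbrev localCentralizer : Type _ :=
  centralizerAlg (Subgroup.inclusion (pointStabilizer_le W b))
    (completion.grp (r.restrict (pointStabilizer_le W b))
      (restrictParam (pointStabilizer_le W b) c) 0)

/-- The power series `1 / (x_α + α(b))` in `ℂ[[V]]`, for `α(b) ≠ 0`. -/
def invShifted (W : Subgroup (V ≃ₗ[ℂ] V)) (b : V) (α : Dual ℂ V) :
    FormalFun (pointStabilizer W b) 0 :=
  Ring.inverse (formalLin (pointStabilizer W b) 0 α + algebraMap ℂ _ (α b))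

end Local

end

end Cherednik

/-!
Germs at the points of the orbit identify the functions near `W b`, by the Chinese remainder
theorem, with the `W_b`-equivariant families of power series `q : W → ℂ[[V]]`, the member of index
`w` being the germ of `w · φ` at `b`. At `b` the Dunkl-Opdam operator of `W` is the one of `W_b`
plus terms in which `1 / α_s` is a power series. So every operator `T` in the completion of
`H_c(W, V)` at `b` acts on families through left multiplications by elements of the completion of
`H_{c'}(W_b, V)` at `0`. As the latter acts faithfully on `ℂ[[V]]`, this defines `θ(T)`,
characterized by `θ(T)(f) ψ = T (f ψ)` for `f` in `Fun_{W_b}(W, -)` and `ψ` in `ℂ[[V]]`.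

The families `f ψ` span all families, so `θ` is injective. For surjectivity, the operators with
values supported at `b` alone, cut out by an idempotent function, realize every element of the
algebra for `W_b`; their conjugates by elements of `W` are matrix units in the completion at `b`.

For uniqueness, an endomorphism of the completion that fixes the generators is linear over the
polynomials on functions, hence continuous for the adic topology, hence the identity.
-/

namespace Cherednik

noncomputable section

open Module

/-! ### Adic completions -/

section AdicCompletion

variable {R : Type*} [CommRing R] {I : Ideal R}

lemma of_mul (x y : R) :
    AdicCompletion.of I R (x * y) = AdicCompletion.of I R x * AdicCompletion.of I R y := rfl

lemma of_smul {k : Type*} [CommSemiring k] [Algebra k R] (t : k) (x : R) :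
    AdicCompletion.of I R (t • x) = t • AdicCompletion.of I R x := rfl

lemma of_algebraMap {k : Type*} [CommRing k] [Algebra k R] (t : k) :
    AdicCompletion.of I R (algebraMap k R t) = algebraMap k _ t := rfl

lemma of_val_eq_zero_iff {x : R} {k : ℕ} : (AdicCompletion.of I R x).val k = 0 ↔ x ∈ I ^ k := by
  rw [AdicCompletion.of_apply, Submodule.mkQ_apply, Submodule.Quotient.mk_eq_zero]
  simp

lemma of_val_eq_of_val_iff {x y : R} {k : ℕ} :
    (AdicCompletion.of I R x).val k = (AdicCompletion.of I R y).val k ↔ x - y ∈ I ^ k := by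
  rw [← of_val_eq_zero_iff, map_sub, AdicCompletion.val_sub_apply, sub_eq_zero]

lemma isUnit_one_sub_of {x : R} (hx : x ∈ I) : IsUnit (1 - AdicCompletion.of I R x) := by
  let f : AdicCompletion.AdicCauchySequence I R :=
    .mk I R (fun n => ∑ i ∈ Finset.range n, x ^ i) fun n => by
      rw [SModEq.comm, SModEq.sub_mem, Finset.sum_range_succ_sub_sum]
      simpa using Ideal.pow_mem_pow hx n
  refine IsUnit.of_mul_eq_one (AdicCompletion.mk I R f) (AdicCompletion.ext_evalₐ fun n => ?_)
  have hpow : Ideal.Quotient.mk (I ^ n) (x ^ n) = 0 :=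
    Ideal.Quotient.eq_zero_iff_mem.2 (Ideal.pow_mem_pow hx n)
  rw [map_mul, map_sub, map_one, AdicCompletion.evalₐ_of, AdicCompletion.evalₐ_mk,
    ← map_one (Ideal.Quotient.mk (I ^ n)), ← map_sub, ← map_mul]
  change Ideal.Quotient.mk (I ^ n) ((1 - x) * ∑ i ∈ Finset.range n, x ^ i) = _
  rw [mul_neg_geom_sum, map_sub, hpow, sub_zero]

lemma val_eq_iff_evalₐ_eq {φ ψ : AdicCompletion I R} {k : ℕ} :
    φ.val k = ψ.val k ↔ AdicCompletion.evalₐ I k φ = AdicCompletion.evalₐ I k ψ := by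
  have h : (I ^ k • ⊤ : Ideal R) = I ^ k := by ext x; simp
  exact (Ideal.quotientEquivAlgOfEq R h).injective.eq_iff.symm

variable {M : Type*} [AddCommGroup M] [Module R M]

lemma exists_of_val_eq (φ : AdicCompletion I M) (k : ℕ) :
    ∃ m : M, φ.val k = (AdicCompletion.of I M m).val k := by
  obtain ⟨m, hm⟩ := Submodule.Quotient.mk_surjective _ (φ.val k)
  exact ⟨m, hm.symm⟩

lemma val_eq_of_le {φ ψ : AdicCompletion I M} {m n : ℕ} (hmn : m ≤ n)
    (h : φ.val n = ψ.val n) : φ.val m = ψ.val m := by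
  rw [← φ.2 hmn, ← ψ.2 hmn]
  exact congrArg (AdicCompletion.transitionMap I M hmn) h

end AdicCompletion

/-- Continuity of a map between adic completions, with a loss of precision bounded uniformly: this
uniformity makes the notion stable under sums and compositions without any reference to topology. -/
def IsAdicContinuous {R S M N : Type*} [CommRing R] [CommRing S] [AddCommGroup M] [Module R M]
    [AddCommGroup N] [Module S N] {I : Ideal R} {J : Ideal S}
    (T : AdicCompletion I M → AdicCompletion J N) : Prop :=
  ∃ d, ∀ k φ ψ, φ.val (k + d) = ψ.val (k + d) → (T φ).val k = (T ψ).val k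

namespace IsAdicContinuous

variable {R S M N : Type*} [CommRing R] [CommRing S] [AddCommGroup M] [Module R M]
  [AddCommGroup N] [Module S N] {I : Ideal R} {J : Ideal S}
  {T T' : AdicCompletion I M → AdicCompletion J N}

lemma const (ψ : AdicCompletion J N) : IsAdicContinuous fun _ : AdicCompletion I M => ψ :=
  ⟨0, fun _ _ _ _ => rfl⟩

lemma id : IsAdicContinuous fun φ : AdicCompletion I M => φ :=
  ⟨0, fun _ _ _ h => h⟩

lemma add (h : IsAdicContinuous T) (h' : IsAdicContinuous T') :
    IsAdicContinuous fun φ => T φ + T' φ := by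
  obtain ⟨d, h⟩ := h
  obtain ⟨d', h'⟩ := h'
  refine ⟨d + d', fun k φ ψ e => ?_⟩
  rw [AdicCompletion.val_add_apply, AdicCompletion.val_add_apply,
    h k φ ψ (val_eq_of_le (by lia) e), h' k φ ψ (val_eq_of_le (by lia) e)]

lemma sub (h : IsAdicContinuous T) (h' : IsAdicContinuous T') :
    IsAdicContinuous fun φ => T φ - T' φ := by
  obtain ⟨d, h⟩ := h
  obtain ⟨d', h'⟩ := h'
  refine ⟨d + d', fun k φ ψ e => ?_⟩
  rw [AdicCompletion.val_sub_apply, AdicCompletion.val_sub_apply,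
    h k φ ψ (val_eq_of_le (by lia) e), h' k φ ψ (val_eq_of_le (by lia) e)]

lemma smul {k : Type*} [SMul k S] [SMul k N] [IsScalarTower k S N] (h : IsAdicContinuous T)
    (t : k) : IsAdicContinuous fun φ => t • T φ := by
  obtain ⟨d, h⟩ := h
  refine ⟨d, fun n φ ψ e => ?_⟩
  rw [AdicCompletion.val_smul_apply, AdicCompletion.val_smul_apply, h n φ ψ e]

lemma mul {T T' : AdicCompletion I M → AdicCompletion J S} (h : IsAdicContinuous T)
    (h' : IsAdicContinuous T') : IsAdicContinuous fun φ => T φ * T' φ := by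
  obtain ⟨d, h⟩ := h
  obtain ⟨d', h'⟩ := h'
  refine ⟨d + d', fun k φ ψ e => ?_⟩
  rw [AdicCompletion.val_mul, AdicCompletion.val_mul,
    h k φ ψ (val_eq_of_le (by lia) e), h' k φ ψ (val_eq_of_le (by lia) e)]

lemma sum {ι : Type*} (s : Finset ι) {T : ι → AdicCompletion I M → AdicCompletion J N}
    (h : ∀ i, IsAdicContinuous (T i)) : IsAdicContinuous fun φ => ∑ i ∈ s, T i φ := by
  classical
  induction s using Finset.induction_on with
  | empty => simpa only [Finset.sum_empty] using const 0
  | insert i s hi ih => simpa only [Finset.sum_insert hi] using (h i).add ih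

lemma comp {R' L : Type*} [CommRing R'] [AddCommGroup L] [Module R' L] {K : Ideal R'}
    {U : AdicCompletion J N → AdicCompletion K L} (hU : IsAdicContinuous U)
    (h : IsAdicContinuous T) : IsAdicContinuous fun φ => U (T φ) := by
  obtain ⟨d, h⟩ := h
  obtain ⟨e, hU⟩ := hU
  exact ⟨e + d, fun k φ ψ hφ => hU k _ _ (h _ φ ψ (by rwa [add_assoc]))⟩

lemma ext (h : IsAdicContinuous T) (h' : IsAdicContinuous T')
    (hof : ∀ m, T (AdicCompletion.of I M m) = T' (AdicCompletion.of I M m))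
    (φ : AdicCompletion I M) : T φ = T' φ := by
  obtain ⟨d, h⟩ := h
  obtain ⟨d', h'⟩ := h'
  refine AdicCompletion.ext fun k => ?_
  obtain ⟨m, hφ⟩ := exists_of_val_eq φ (k + (d + d'))
  rw [h k _ _ (val_eq_of_le (by lia) hφ), hof, h' k _ _ (val_eq_of_le (by lia) hφ)]

lemma of_linearMap {L : Type*} [AddCommGroup L] [Module R L] (hI : I.FG)
    (T : AdicCompletion I M →ₗ[R] AdicCompletion I L) : IsAdicContinuous T := by
  refine ⟨0, fun k φ ψ h => ?_⟩
  have hmem : φ - ψ ∈ (I ^ k • ⊤ : Submodule R (AdicCompletion I M)) := by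
    rw [AdicCompletion.pow_smul_top_eq_ker_eval hI, LinearMap.mem_ker, map_sub, sub_eq_zero]
    exact h
  have hT : T (φ - ψ) ∈ (I ^ k • ⊤ : Submodule R (AdicCompletion I L)) :=
    Submodule.smul_top_le_comap_smul_top _ T hmem
  rwa [AdicCompletion.pow_smul_top_eq_ker_eval hI, LinearMap.mem_ker, map_sub, map_sub,
    sub_eq_zero] at hT

end IsAdicContinuous

variable {V : Type*} [AddCommGroup V] [Module ℂ V] {W : Subgroup (V ≃ₗ[ℂ] V)}

/-! ### Reflections -/

section Dunkl

@[simp]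
lemma dualAct_apply (w : V ≃ₗ[ℂ] V) (α : Dual ℂ V) (v : V) : dualAct w α v = α (w⁻¹ v) := rfl

lemma dualAct_mul (u v : V ≃ₗ[ℂ] V) (α : Dual ℂ V) :
    dualAct (u * v) α = dualAct u (dualAct v α) := by
  ext; simp

lemma dualAct_one (α : Dual ℂ V) : dualAct (1 : V ≃ₗ[ℂ] V) α = α := by
  ext; simp

lemma dualAct_injective (w : V ≃ₗ[ℂ] V) : Function.Injective (dualAct w) := by
  intro α β h
  simpa only [← dualAct_mul, inv_mul_cancel, dualAct_one] using congrArg (dualAct w⁻¹) h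

lemma polyAct_lin (w : V ≃ₗ[ℂ] V) (α : Dual ℂ V) : polyAct w (lin α) = lin (dualAct w α) := by
  simp [polyAct]

instance finite_reflections [Finite W] : Finite (reflections W) :=
  Finite.of_injective (fun s : reflections W => (⟨s, s.2.1⟩ : W)) fun s t h => by
    simpa [Subtype.ext_iff] using h

instance fintype_reflections [Finite (reflections W)] : Fintype (reflections W) :=
  Fintype.ofFinite _

instance finite_pointStabilizer [Finite W] (b : V) : Finite (pointStabilizer W b) :=
  Finite.of_injective _ (Subgroup.inclusion_injective (pointStabilizer_le W b))

lemma conj_mem_reflections {w s : V ≃ₗ[ℂ] V} (hw : w ∈ W) (hs : s ∈ reflections W) :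
    w * s * w⁻¹ ∈ reflections W := by
  refine ⟨W.mul_mem (W.mul_mem hw hs.1) (W.inv_mem hw), fun h => hs.2.1 (conj_eq_one_iff.1 h), ?_⟩
  have h : (w * s * w⁻¹).toLinearMap - LinearMap.id =
      w.toLinearMap ∘ₗ (s.toLinearMap - LinearMap.id) ∘ₗ (w⁻¹ : V ≃ₗ[ℂ] V).toLinearMap := by
    ext v
    simp
  rw [h, LinearMap.range_comp, LinearMap.range_comp_of_range_eq_top _ (LinearEquiv.range _),
    LinearEquiv.finrank_map_eq]
  exact hs.2.2

/-- Conjugation by `w ∈ W` on the reflections of `W`. -/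
def conjReflection (w : W) : reflections W ≃ reflections W where
  toFun s := ⟨_, conj_mem_reflections w.2 s.2⟩
  invFun s := ⟨_, conj_mem_reflections (w⁻¹).2 s.2⟩
  left_inv s := by ext1; simp [mul_assoc]
  right_inv s := by ext1; simp [mul_assoc]

lemma coe_conjReflection (w : W) (s : reflections W) :
    (conjReflection w s : V ≃ₗ[ℂ] V) = (w : V ≃ₗ[ℂ] V) * s * (w : V ≃ₗ[ℂ] V)⁻¹ := rfl

variable (r : Roots W)

lemma coroot_ne_zero (s : reflections W) : r.coroot s ≠ 0 := by
  intro h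
  simpa [h] using r.pairing s

lemma reflection_inv_apply (s : reflections W) (v : V) :
    (s : V ≃ₗ[ℂ] V)⁻¹ v = v - ((1 - r.eig s) / 2 * r.root s v) • r.coroot s := by
  have hmem : (s : V ≃ₗ[ℂ] V)⁻¹ v - v ∈ Submodule.span ℂ {r.coroot s} := by
    rw [r.span_coroot s]
    exact ⟨-((s : V ≃ₗ[ℂ] V)⁻¹ v), by simp [neg_add_eq_sub]⟩
  obtain ⟨t, ht⟩ := Submodule.mem_span_singleton.1 hmem
  have hinv : (s : V ≃ₗ[ℂ] V)⁻¹ v = v + t • r.coroot s := by rw [ht]; abel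
  have heig := LinearMap.congr_fun (r.eig_spec s) v
  simp only [dualAct_apply, hinv, map_add, map_smul, r.pairing, smul_eq_mul,
    LinearMap.smul_apply] at heig
  have htv : t = -((1 - r.eig s) / 2 * r.root s v) := by linear_combination heig / 2
  rw [hinv, htv]
  module

lemma dualAct_reflection (s : reflections W) (α : Dual ℂ V) :
    dualAct (s : V ≃ₗ[ℂ] V) α = α - ((1 - r.eig s) / 2 * α (r.coroot s)) • r.root s := by
  ext v
  simp only [dualAct_apply, reflection_inv_apply r s v, map_sub, map_smul, smul_eq_mul,
    LinearMap.sub_apply, LinearMap.smul_apply]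
  ring

lemma one_sub_eig_ne_zero (s : reflections W) : 1 - r.eig s ≠ 0 := by
  intro h
  refine s.2.2.1 (inv_eq_one.1 ?_)
  ext v
  simp [reflection_inv_apply r s v, h]

lemma reflection_apply_eq_self_iff (s : reflections W) (v : V) :
    (s : V ≃ₗ[ℂ] V) v = v ↔ r.root s v = 0 := by
  have hinv : (s : V ≃ₗ[ℂ] V) v = v ↔ (s : V ≃ₗ[ℂ] V)⁻¹ v = v :=
    ((LinearEquiv.symm_apply_eq (s : V ≃ₗ[ℂ] V)).trans eq_comm).symm
  rw [hinv, reflection_inv_apply r s v, sub_eq_self, smul_eq_zero,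
    or_iff_left (coroot_ne_zero r s), mul_eq_zero,
    or_iff_right (div_ne_zero (one_sub_eig_ne_zero r s) two_ne_zero)]

lemma exists_eq_smul_root {s : reflections W} {β : Dual ℂ V} {t : ℂ} (ht : t ≠ 1)
    (hβ : dualAct (s : V ≃ₗ[ℂ] V) β = t • β) : ∃ k : ℂ, β = k • r.root s := by
  have h : (1 - t) • β = ((1 - r.eig s) / 2 * β (r.coroot s)) • r.root s := by
    rw [sub_smul, one_smul, ← hβ, dualAct_reflection r s β, sub_sub_cancel]
  exact ⟨_, by rw [mul_smul, ← h, inv_smul_smul₀ (sub_ne_zero.2 ht.symm)]⟩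

lemma eig_eq_of_dualAct_eq_smul {s : reflections W} {β : Dual ℂ V} (hβ0 : β ≠ 0) {t : ℂ}
    (ht : t ≠ 1) (hβ : dualAct (s : V ≃ₗ[ℂ] V) β = t • β) : r.eig s = t := by
  obtain ⟨k, rfl⟩ := exists_eq_smul_root r ht hβ
  rw [map_smul, r.eig_spec, smul_comm] at hβ
  exact smul_left_injective ℂ hβ0 hβ

lemma dualAct_conjReflection_dualAct_root (w : W) (s : reflections W) :
    dualAct (conjReflection w s : V ≃ₗ[ℂ] V) (dualAct (w : V ≃ₗ[ℂ] V) (r.root s)) =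
      r.eig s • dualAct (w : V ≃ₗ[ℂ] V) (r.root s) := by
  rw [← dualAct_mul, coe_conjReflection, inv_mul_cancel_right, dualAct_mul, r.eig_spec, map_smul]

lemma eig_conjReflection (w : W) (s : reflections W) :
    r.eig (conjReflection w s) = r.eig s :=
  eig_eq_of_dualAct_eq_smul r
    ((map_ne_zero_iff _ (dualAct_injective _)).2 (root_ne_zero r s))
    (sub_ne_zero.1 (one_sub_eig_ne_zero r s)).symm (dualAct_conjReflection_dualAct_root r w s)

lemma exists_dualAct_root_eq_smul (w : W) (s : reflections W) :
    ∃ k : ℂ, dualAct (w : V ≃ₗ[ℂ] V) (r.root s) = k • r.root (conjReflection w s) :=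
  exists_eq_smul_root r (sub_ne_zero.1 (one_sub_eig_ne_zero r s)).symm
    (dualAct_conjReflection_dualAct_root r w s)

/-! ### Dunkl operators on polynomial functions -/

lemma deriv_algebraMap (a : V) (t : ℂ) : deriv a (algebraMap ℂ _ t) = 0 := by
  simp [deriv, TrivSqZeroExt.algebraMap_eq_inl']

lemma deriv_add_left (a a' : V) (F : Poly V) : deriv (a + a') F = deriv a F + deriv a' F := by
  induction F using SymmetricAlgebra.induction with
  | algebraMap t => simp [deriv_algebraMap]
  | ι α => simp only [deriv_lin, map_add]
  | mul F G hF hG => simp only [deriv_mul, hF, hG]; ring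
  | add F G hF hG => simp only [map_add, hF, hG]; ring

lemma deriv_smul_left (t : ℂ) (a : V) (F : Poly V) : deriv (t • a) F = t • deriv a F := by
  induction F using SymmetricAlgebra.induction with
  | algebraMap t => simp [deriv_algebraMap]
  | ι α => simp only [deriv_lin, map_smul, smul_eq_mul, map_mul, Algebra.smul_def]
  | mul F G hF hG => simp only [deriv_mul, hF, hG, smul_add, smul_mul_assoc, mul_smul_comm]
  | add F G hF hG => simp only [map_add, hF, hG, smul_add]

lemma polyAct_deriv (w : V ≃ₗ[ℂ] V) (a : V) (F : Poly V) :
    polyAct w (deriv a F) = deriv (w a) (polyAct w F) := by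
  induction F using SymmetricAlgebra.induction with
  | algebraMap t => simp [deriv_algebraMap]
  | ι α =>
    have hw : w⁻¹ (w a) = a := w.symm_apply_apply a
    simp [deriv_lin, polyAct_lin, hw]
  | mul F G hF hG => simp only [deriv_mul, map_mul, map_add, hF, hG]
  | add F G hF hG => simp only [map_add, hF, hG]

lemma divDiff_lin (s : reflections W) (α : Dual ℂ V) :
    divDiff r s (lin α) = algebraMap ℂ _ (-((1 - r.eig s) / 2 * α (r.coroot s))) := by
  apply mul_left_cancel₀ (lin_root_ne_zero r s)
  rw [root_mul_divDiff, polyAct_lin, dualAct_reflection r s, mul_comm (lin _),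
    ← Algebra.smul_def, neg_smul]
  simp [lin]

lemma divDiff_algebraMap (s : reflections W) (t : ℂ) : divDiff r s (algebraMap ℂ _ t) = 0 := by
  apply mul_left_cancel₀ (lin_root_ne_zero r s)
  simp [root_mul_divDiff]

lemma polyAct_divDiff (w : W) (s : reflections W) (a : V) (F : Poly V) :
    r.root s a • polyAct (w : V ≃ₗ[ℂ] V) (divDiff r s F) =
      r.root (conjReflection w s) ((w : V ≃ₗ[ℂ] V) a) •
        divDiff r (conjReflection w s) (polyAct (w : V ≃ₗ[ℂ] V) F) := by
  obtain ⟨k, hk⟩ := exists_dualAct_root_eq_smul r w s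
  have hpoly : polyAct (w : V ≃ₗ[ℂ] V) (lin (r.root s)) =
      k • lin (r.root (conjReflection w s)) := by
    rw [polyAct_lin, hk, lin, map_smul]
  have happly : r.root s a = k * r.root (conjReflection w s) ((w : V ≃ₗ[ℂ] V) a) := by
    have := LinearMap.congr_fun hk ((w : V ≃ₗ[ℂ] V) a)
    rwa [dualAct_apply, ← LinearEquiv.mul_apply, inv_mul_cancel] at this
  have hconj : polyAct (conjReflection w s : V ≃ₗ[ℂ] V) (polyAct (w : V ≃ₗ[ℂ] V) F) =
      polyAct (w : V ≃ₗ[ℂ] V) (polyAct (s : V ≃ₗ[ℂ] V) F) := by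
    rw [← AlgHom.comp_apply, ← AlgHom.comp_apply, ← polyAct_mul, ← polyAct_mul,
      coe_conjReflection, inv_mul_cancel_right]
  apply mul_left_cancel₀ (lin_root_ne_zero r (conjReflection w s))
  rw [mul_smul_comm, mul_smul_comm, root_mul_divDiff, hconj, happly, ← map_sub,
    ← root_mul_divDiff r s, map_mul, hpoly, smul_mul_assoc, smul_smul, mul_comm k]

lemma map_eq_mul_map_one_of_map_lin_mul {C : Poly V →ₗ[ℂ] Poly V}
    (hC : ∀ α F, C (lin α * F) = lin α * C F) (F : Poly V) : C F = F * C 1 := by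
  suffices h : ∀ G, C (F * G) = F * C G by simpa using h 1
  induction F using SymmetricAlgebra.induction with
  | algebraMap t => intro G; simp only [← Algebra.smul_def, map_smul]
  | ι α => exact hC α
  | mul F G hF hG => intro K; rw [mul_assoc, hF, hG, mul_assoc]
  | add F G hF hG => intro K; rw [add_mul, map_add, hF, hG, add_mul]

section Finite

variable [Finite (reflections W)] (c : reflections W → ℂ)

lemma dunkl_apply (a : V) (F : Poly V) : dunkl r c a F =
    deriv a F + ∑ s, (2 * c s / (1 - r.eig s) * r.root s a) • divDiff r s F := by
  simp [dunkl, finsum_eq_sum_of_fintype]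

lemma dunkl_add_left (a a' : V) : dunkl r c (a + a') = dunkl r c a + dunkl r c a' := by
  ext1 F
  simp only [LinearMap.add_apply, dunkl_apply, deriv_add_left, map_add, mul_add, add_smul,
    Finset.sum_add_distrib]
  abel

lemma dunkl_smul_left (t : ℂ) (a : V) : dunkl r c (t • a) = t • dunkl r c a := by
  ext1 F
  simp only [LinearMap.smul_apply, dunkl_apply, deriv_smul_left, map_smul, smul_add,
    Finset.smul_sum, smul_smul, smul_eq_mul, mul_left_comm t]

lemma dunkl_one (a : V) : dunkl r c a 1 = 0 := by
  rw [← map_one (algebraMap ℂ (Poly V))]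
  simp only [dunkl_apply, deriv_algebraMap, divDiff_algebraMap, smul_zero, Finset.sum_const_zero,
    add_zero]

lemma dunkl_lin_mul (a : V) (α : Dual ℂ V) (F : Poly V) :
    dunkl r c a (lin α * F) = lin α * dunkl r c a F + (α a • F -
      ∑ s : reflections W, (c s * r.root s a * α (r.coroot s)) • polyAct (s : V ≃ₗ[ℂ] V) F) := by
  have hterm (s : reflections W) :
      (2 * c s / (1 - r.eig s) * r.root s a) • divDiff r s (lin α * F) =
        lin α * ((2 * c s / (1 - r.eig s) * r.root s a) • divDiff r s F) -
          (c s * r.root s a * α (r.coroot s)) • polyAct (s : V ≃ₗ[ℂ] V) F := by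
    have hs := one_sub_eig_ne_zero r s
    have hcoeff : 2 * c s / (1 - r.eig s) * r.root s a *
        -((1 - r.eig s) / 2 * α (r.coroot s)) = -(c s * r.root s a * α (r.coroot s)) := by
      field_simp
    rw [mul_comm (lin α) F, divDiff_mul, divDiff_lin, mul_comm (polyAct _ _),
      ← Algebra.smul_def, smul_add, smul_smul, mul_comm _ (lin α), mul_smul_comm, hcoeff,
      neg_smul, ← sub_eq_add_neg]
  simp only [dunkl_apply, hterm, deriv_mul, deriv_lin, Finset.sum_sub_distrib, mul_add,
    Finset.mul_sum, Algebra.smul_def]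
  ring

variable {c} (hc : IsInvariant c)
include hc

lemma polyAct_dunkl (w : W) (a : V) (F : Poly V) :
    polyAct (w : V ≃ₗ[ℂ] V) (dunkl r c a F) =
      dunkl r c ((w : V ≃ₗ[ℂ] V) a) (polyAct (w : V ≃ₗ[ℂ] V) F) := by
  simp only [dunkl_apply, map_add, map_sum, map_smul, polyAct_deriv]
  congr 1
  refine Fintype.sum_equiv (conjReflection w) _ _ fun s => ?_
  rw [eig_conjReflection, hc s (conjReflection w s) w w.2 rfl, mul_smul, mul_smul,
    polyAct_divDiff]

lemma polyAct_reflection_dunkl (s : reflections W) (a : V) (F : Poly V) :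
    polyAct (s : V ≃ₗ[ℂ] V) (dunkl r c a F) = dunkl r c a (polyAct (s : V ≃ₗ[ℂ] V) F) +
      ((1 - r.eig s) / 2 * r.root s a) •
        polyAct (s : V ≃ₗ[ℂ] V) (dunkl r c (r.coroot s) F) := by
  have hact := polyAct_dunkl r hc ⟨s, s.2.1⟩ ((s : V ≃ₗ[ℂ] V)⁻¹ a) F
  have hs : (s : V ≃ₗ[ℂ] V) ((s : V ≃ₗ[ℂ] V)⁻¹ a) = a := LinearEquiv.apply_symm_apply _ _
  have hinv : dunkl r c ((s : V ≃ₗ[ℂ] V)⁻¹ a) = dunkl r c a +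
      (-((1 - r.eig s) / 2 * r.root s a)) • dunkl r c (r.coroot s) := by
    rw [reflection_inv_apply r s, sub_eq_add_neg, ← neg_smul, dunkl_add_left, dunkl_smul_left]
  rw [hs, hinv] at hact
  simp only [LinearMap.add_apply, LinearMap.smul_apply, map_add, map_smul] at hact
  rw [← hact]
  module

lemma dunkl_commutator_lin_mul (a a' : V) (α : Dual ℂ V) (F : Poly V) :
    dunkl r c a (dunkl r c a' (lin α * F)) - dunkl r c a' (dunkl r c a (lin α * F)) =
      lin α * (dunkl r c a (dunkl r c a' F) - dunkl r c a' (dunkl r c a F)) := by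
  simp only [dunkl_lin_mul, map_add, map_sub, map_sum, map_smul, mul_sub]
  simp only [fun s => polyAct_reflection_dunkl r hc s a F,
    fun s => polyAct_reflection_dunkl r hc s a' F, smul_add, Finset.sum_add_distrib, smul_smul]
  have hsymm : ∑ s, (c s * r.root s a * α (r.coroot s) * ((1 - r.eig s) / 2 * r.root s a')) •
        polyAct (s : V ≃ₗ[ℂ] V) (dunkl r c (r.coroot s) F) =
      ∑ s, (c s * r.root s a' * α (r.coroot s) * ((1 - r.eig s) / 2 * r.root s a)) •
        polyAct (s : V ≃ₗ[ℂ] V) (dunkl r c (r.coroot s) F) := by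
    congr! 2
    ring
  rw [hsymm]
  abel

/-- The commutator of two Dunkl operators commutes with multiplication by linear forms, so it is
multiplication by its value at `1`, which vanishes. -/
lemma dunkl_comm (a a' : V) (F : Poly V) :
    dunkl r c a (dunkl r c a' F) = dunkl r c a' (dunkl r c a F) := by
  have h := map_eq_mul_map_one_of_map_lin_mul
    (C := dunkl r c a ∘ₗ dunkl r c a' - dunkl r c a' ∘ₗ dunkl r c a)
    (dunkl_commutator_lin_mul r hc a a') F
  simp only [LinearMap.sub_apply, LinearMap.comp_apply, dunkl_one, map_zero, sub_zero,
    mul_zero] at h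
  exact sub_eq_zero.1 h

end Finite

end Dunkl

/-! ### The natural homomorphism -/

section NaturalHom

variable {r : Roots W} {c : reflections W → ℂ} {b : V}

lemma isAdicContinuous_extend (D : shiftOps W b) : IsAdicContinuous (extend D) :=
  ⟨1, fun k _ _ h => congrArg (extendAux D k) h⟩

lemma isAdicContinuous_of_mem_completion {T : Module.End ℂ (FormalFun W b)}
    (hT : T ∈ completion r c b) : IsAdicContinuous T := by
  induction hT using Algebra.adjoin_induction with
  | mem T hT =>
    obtain ((⟨φ, rfl⟩ | ⟨u, rfl⟩) | ⟨a, rfl⟩) := hT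
    · exact (IsAdicContinuous.const φ).mul .id
    · exact isAdicContinuous_extend _
    · exact isAdicContinuous_extend _
  | algebraMap t => exact IsAdicContinuous.id.smul t
  | add T T' _ _ h h' => exact h.add h'
  | mul T T' _ _ h h' => exact h.comp h'

lemma completion_ext {T T' : completion r c b}
    (h : ∀ F, T.1 (AdicCompletion.of _ _ F) = T'.1 (AdicCompletion.of _ _ F)) : T = T' :=
  Subtype.ext <| LinearMap.ext <|
    (isAdicContinuous_of_mem_completion T.2).ext (isAdicContinuous_of_mem_completion T'.2) h

lemma func_of (G F : Poly V) :
    (completion.func r c b (AdicCompletion.of _ _ G)).1 (AdicCompletion.of _ _ F) =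
      AdicCompletion.of _ _ (G * F) := rfl

lemma grp_of (w : W) (F : Poly V) :
    (completion.grp r c b w).1 (AdicCompletion.of _ _ F) =
      AdicCompletion.of _ _ (polyAct (w : V ≃ₗ[ℂ] V) F) := rfl

lemma dunklOp_of (a : V) (F : Poly V) :
    (completion.dunklOp r c b a).1 (AdicCompletion.of _ _ F) =
      AdicCompletion.of _ _ (dunkl r c a F) := rfl

lemma grp_mul_dunklOp [Finite (reflections W)] (hc : IsInvariant c) (w : W) (a : V) :
    completion.grp r c b w * completion.dunklOp r c b a =
      completion.dunklOp r c b ((w : V ≃ₗ[ℂ] V) a) * completion.grp r c b w := by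
  refine completion_ext fun F => ?_
  rw [MulMemClass.coe_mul, MulMemClass.coe_mul, Module.End.mul_apply, Module.End.mul_apply,
    dunklOp_of, grp_of, grp_of, dunklOp_of, polyAct_dunkl r hc]

variable (r c b) in
/-- The images of the generators of `H_c(W, V)` in its completion at `b`. -/
def genMap : Gen W → completion r c b
  | .grp w => completion.grp r c b w
  | .x α => completion.func r c b (formalLin W b α)
  | .y a => completion.dunklOp r c b a

lemma lift_genMap_eq_of_rel [Finite (reflections W)] (hc : IsInvariant c)
    {p q : FreeAlgebra ℂ (Gen W)} (h : Rel r c p q) :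
    FreeAlgebra.lift ℂ (genMap r c b) p = FreeAlgebra.lift ℂ (genMap r c b) q := by
  induction h <;>
    simp only [map_one, map_mul, map_add, map_smul, map_sub, map_sum, AlgHom.commutes,
      finsum_eq_sum_of_fintype, FreeAlgebra.lift_ι_apply, genMap]
  case grp_y w a => exact grp_mul_dunklOp hc w a
  all_goals refine completion_ext fun F => ?_
  case x_add α β => simp [formalLin, lin, completion.func, add_mul]
  case x_smul t α => simp [formalLin, lin, completion.func]
  case y_add a a' => simp [dunklOp_of, dunkl_add_left]
  case y_smul t a => simp [dunklOp_of, dunkl_smul_left]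
  case grp_x w α => simp [formalLin, func_of, grp_of, polyAct_lin]
  case x_comm α β => simp [formalLin, func_of, mul_left_comm]
  case y_comm a a' => simp [dunklOp_of, dunkl_comm r hc a a']
  case y_x a α =>
    simp [formalLin, func_of, dunklOp_of, grp_of, dunkl_lin_mul, LinearMap.sum_apply]

variable (r b) in
/-- The natural homomorphism from `H_c(W, V)` to its completion at `b`. -/
def naturalHom [Finite (reflections W)] (hc : IsInvariant c) : Alg r c →ₐ[ℂ] completion r c b :=
  RingQuot.liftAlgHom ℂ
    ⟨FreeAlgebra.lift ℂ (genMap r c b), fun _ _ h => lift_genMap_eq_of_rel hc h⟩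

lemma isNatural_naturalHom [Finite (reflections W)] (hc : IsInvariant c) :
    IsNatural r c b (naturalHom r b hc) := by
  refine ⟨fun w => ?_, fun α => ?_, fun a => ?_⟩ <;>
    simp [naturalHom, Alg.grp, Alg.x, Alg.y, genMap]

end NaturalHom

/-! ### Translations and ideals of points -/

section Points

/-- Translation of polynomial functions: `F(v) ↦ F(v + p)`. -/
def polyShift (p : V) : Poly V →ₐ[ℂ] Poly V :=
  SymmetricAlgebra.lift (SymmetricAlgebra.ι ℂ (Dual ℂ V) +
    Algebra.linearMap ℂ (Poly V) ∘ₗ Dual.eval ℂ V p)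

lemma polyShift_lin (p : V) (α : Dual ℂ V) :
    polyShift p (lin α) = lin α + algebraMap ℂ _ (α p) := by
  simp [polyShift]

lemma polyShift_zero : polyShift (0 : V) = AlgHom.id ℂ (Poly V) := by
  apply SymmetricAlgebra.algHom_ext
  ext α
  simp [polyShift]

lemma polyShift_add (p q : V) : polyShift (p + q) = (polyShift p).comp (polyShift q) := by
  apply SymmetricAlgebra.algHom_ext
  ext α
  simp [polyShift, add_assoc]

lemma polyShift_polyAct (w : V ≃ₗ[ℂ] V) (p : V) (F : Poly V) :
    polyShift (w p) (polyAct w F) = polyAct w (polyShift p F) := by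
  have h : (polyShift (w p)).comp (polyAct w) = (polyAct w).comp (polyShift p) := by
    apply SymmetricAlgebra.algHom_ext
    ext α
    simp [polyShift, polyAct]
  exact DFunLike.congr_fun h F

lemma polyShift_deriv (a p : V) (F : Poly V) :
    polyShift p (deriv a F) = deriv a (polyShift p F) := by
  induction F using SymmetricAlgebra.induction with
  | algebraMap t => simp [deriv_algebraMap]
  | ι α => simp [deriv_lin, polyShift_lin, deriv_algebraMap]
  | mul F G hF hG => simp only [deriv_mul, map_mul, map_add, hF, hG]
  | add F G hF hG => simp only [map_add, hF, hG]

lemma evalAt_lin (p : V) (α : Dual ℂ V) : evalAt p (lin α) = α p := by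
  simp [evalAt]

lemma evalAt_polyShift (p q : V) (F : Poly V) : evalAt q (polyShift p F) = evalAt (q + p) F := by
  have h : (evalAt q).comp (polyShift p) = evalAt (q + p) := by
    apply SymmetricAlgebra.algHom_ext
    ext α
    simp [evalAt, polyShift]
  exact DFunLike.congr_fun h F

/-- The ideal of polynomial functions vanishing at `p`. -/
abbrev pointIdeal (p : V) : Ideal (Poly V) := RingHom.ker (evalAt p)

lemma isCoprime_pointIdeal {p q : V} (h : p ≠ q) : IsCoprime (pointIdeal p) (pointIdeal q) := by
  obtain ⟨α, hα⟩ : ∃ α : Dual ℂ V, α (p - q) ≠ 0 := by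
    by_contra! h0
    exact h (sub_eq_zero.1 ((Module.forall_dual_apply_eq_zero_iff ℂ _).1 h0))
  rw [map_sub] at hα
  rw [Ideal.isCoprime_iff_exists]
  refine ⟨(α q - α p)⁻¹ • (lin α - algebraMap ℂ _ (α p)), ?_,
    (α p - α q)⁻¹ • (lin α - algebraMap ℂ _ (α q)), ?_, ?_⟩
  · simp [RingHom.mem_ker, evalAt_lin]
  · simp [RingHom.mem_ker, evalAt_lin]
  · rw [← neg_sub (α p), inv_neg, neg_smul, neg_add_eq_sub, ← smul_sub, sub_sub_sub_cancel_left,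
      ← map_sub (algebraMap ℂ (Poly V)), Algebra.smul_def, ← map_mul, inv_mul_cancel₀ hα, map_one]

lemma pairwise_isCoprime_pointIdeal_pow (O : Set V) (k : ℕ) :
    Pairwise (Function.onFun IsCoprime fun p : O => pointIdeal (p : V) ^ k) := fun _ _ h =>
  (isCoprime_pointIdeal fun e => h (Subtype.ext e)).pow

lemma orbitIdeal_zero : orbitIdeal W (0 : V) = pointIdeal 0 := by
  simp [orbitIdeal]

variable (b : V)

variable (W) in
/-- The points `w⁻¹ b` of the orbit of `b`. -/
abbrev orbitPoints : Set V := Set.range fun w : W => (w : V ≃ₗ[ℂ] V)⁻¹ b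

lemma orbitIdeal_eq_iInf : orbitIdeal W b = ⨅ p : orbitPoints W b, pointIdeal (p : V) := by
  rw [iInf_range' (fun p => pointIdeal p), orbitIdeal, ← (Equiv.inv W).iInf_comp]
  rfl

lemma mem_orbitIdeal_pow_iff [Finite W] {k : ℕ} {F : Poly V} :
    F ∈ orbitIdeal W b ^ k ↔ ∀ w : W, F ∈ pointIdeal ((w : V ≃ₗ[ℂ] V)⁻¹ b) ^ k := by
  have := Fintype.ofFinite (orbitPoints W b)
  have prod_eq_iInf (n : ℕ) : ∏ p : orbitPoints W b, pointIdeal (p : V) ^ n =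
      ⨅ p : orbitPoints W b, pointIdeal (p : V) ^ n := by
    rw [Ideal.prod_eq_iInf_of_pairwise_isCoprime
      fun p _ q _ => @pairwise_isCoprime_pointIdeal_pow V _ _ (orbitPoints W b) n p q]
    simp only [Finset.mem_univ, iInf_pos]
  have orbitIdeal_eq_prod : orbitIdeal W b = ∏ p : orbitPoints W b, pointIdeal (p : V) := by
    simpa only [pow_one, orbitIdeal_eq_iInf] using (prod_eq_iInf 1).symm
  rw [orbitIdeal_eq_prod, ← Finset.prod_pow, prod_eq_iInf, Submodule.mem_iInf]
  simp only [Subtype.forall, Set.forall_mem_range]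

lemma exists_inclusion_mul_eq {b : V} {u w : W}
    (h : (w : V ≃ₗ[ℂ] V)⁻¹ b = (u : V ≃ₗ[ℂ] V)⁻¹ b) :
    ∃ g : pointStabilizer W b, Subgroup.inclusion (pointStabilizer_le W b) g * u = w := by
  refine ⟨⟨(w : V ≃ₗ[ℂ] V) * (u : V ≃ₗ[ℂ] V)⁻¹, W.mul_mem w.2 (W.inv_mem u.2), ?_⟩, ?_⟩
  · change (w : V ≃ₗ[ℂ] V) ((u : V ≃ₗ[ℂ] V)⁻¹ b) = b
    rw [← h]
    exact LinearEquiv.apply_symm_apply _ _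
  · ext1
    simp

end Points

/-! ### Germs of functions on the formal neighbourhood of an orbit -/

section Germs

lemma ringEquiv_mem_pow_iff {R S : Type*} [CommRing R] [CommRing S] (e : R ≃+* S) {I : Ideal R}
    {J : Ideal S} (h : ∀ x, e x ∈ J ↔ x ∈ I) {k : ℕ} {x : R} : e x ∈ J ^ k ↔ x ∈ I ^ k := by
  have hI : I = J.comap e := Ideal.ext fun x => (h x).symm
  rw [hI, ← Ideal.map_symm, ← Ideal.map_pow, Ideal.map_symm, Ideal.mem_comap]

variable (b : V)

/-- The expansion of a polynomial function at `w⁻¹ b`, moved to the origin by `w`: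
`F(v) ↦ F(w⁻¹ (v + b))`. -/
def polyGerm (w : W) : Poly V ≃ₐ[ℂ] Poly V :=
  .ofAlgHom ((polyShift b).comp (polyAct w)) ((polyAct (w : V ≃ₗ[ℂ] V)⁻¹).comp (polyShift (-b)))
    (by
      rw [AlgHom.comp_assoc, ← AlgHom.comp_assoc (polyAct (w : V ≃ₗ[ℂ] V)), ← polyAct_mul,
        mul_inv_cancel, polyAct_one, AlgHom.id_comp, ← polyShift_add, add_neg_cancel,
        polyShift_zero])
    (by
      rw [AlgHom.comp_assoc, ← AlgHom.comp_assoc (polyShift (-b)), ← polyShift_add,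
        neg_add_cancel, polyShift_zero, AlgHom.id_comp, ← polyAct_mul, inv_mul_cancel,
        polyAct_one])

lemma polyGerm_apply (w : W) (F : Poly V) :
    polyGerm b w F = polyShift b (polyAct (w : V ≃ₗ[ℂ] V) F) := rfl

lemma polyGerm_inclusion_mul (h : pointStabilizer W b) (w : W) (F : Poly V) :
    polyGerm b (Subgroup.inclusion (pointStabilizer_le W b) h * w) F =
      polyAct (h : V ≃ₗ[ℂ] V) (polyGerm b w F) := by
  have hb : (h : V ≃ₗ[ℂ] V) b = b := h.2.2
  rw [polyGerm_apply, polyGerm_apply, ← polyShift_polyAct, hb, ← AlgHom.comp_apply (polyAct _),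
    ← polyAct_mul]
  rfl

lemma polyGerm_mem_pow_iff {w : W} {k : ℕ} {F : Poly V} :
    polyGerm b w F ∈ orbitIdeal (pointStabilizer W b) 0 ^ k ↔
      F ∈ pointIdeal ((w : V ≃ₗ[ℂ] V)⁻¹ b) ^ k := by
  refine ringEquiv_mem_pow_iff (polyGerm b w).toRingEquiv fun F => ?_
  change polyGerm b w F ∈ _ ↔ _
  rw [orbitIdeal_zero, RingHom.mem_ker, RingHom.mem_ker, polyGerm_apply, evalAt_polyShift,
    zero_add, evalAt_polyAct]

variable [Finite W]

lemma mem_orbitIdeal_pow_iff_polyGerm {k : ℕ} {F : Poly V} :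
    F ∈ orbitIdeal W b ^ k ↔
      ∀ w : W, polyGerm b w F ∈ orbitIdeal (pointStabilizer W b) 0 ^ k := by
  simp only [polyGerm_mem_pow_iff, mem_orbitIdeal_pow_iff b]

/-- The germ at `w⁻¹ b` modulo the `k`-th power of the ideal of the origin. -/
def germMod (w : W) (k : ℕ) :
    FormalFun W b →ₐ[ℂ] Poly V ⧸ orbitIdeal (pointStabilizer W b) (0 : V) ^ k :=
  (Ideal.quotientMapₐ _ (polyGerm b w : Poly V →ₐ[ℂ] Poly V)
    fun _ hF => (mem_orbitIdeal_pow_iff_polyGerm b).1 hF w).comp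
      ((AdicCompletion.evalₐ (orbitIdeal W b) k).restrictScalars ℂ)

lemma germMod_eq (w : W) {φ : FormalFun W b} {k : ℕ} {F : Poly V}
    (h : φ.val k = (AdicCompletion.of _ _ F).val k) :
    germMod b w k φ = Ideal.Quotient.mk _ (polyGerm b w F) := by
  rw [val_eq_iff_evalₐ_eq] at h
  rw [germMod, AlgHom.comp_apply, AlgHom.restrictScalars_apply, h, AdicCompletion.evalₐ_of]
  rfl

lemma factor_comp_germMod (w : W) {m n : ℕ} (hmn : m ≤ n) :
    (Ideal.Quotient.factorₐ ℂ (Ideal.pow_le_pow_right hmn)).comp (germMod b w n) =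
      germMod b w m := by
  ext φ
  obtain ⟨F, hF⟩ := exists_of_val_eq φ n
  rw [AlgHom.comp_apply, germMod_eq b w hF, germMod_eq b w (val_eq_of_le hmn hF)]
  rfl

/-- The germ at `w⁻¹ b` of a function on the formal neighbourhood of the orbit of `b`, moved to the
origin by `w`. -/
def germ (w : W) : FormalFun W b →ₐ[ℂ] FormalFun (pointStabilizer W b) 0 :=
  AdicCompletion.liftAlgHom _ (germMod b w) (factor_comp_germMod b w)

variable {b}

lemma germ_val_eq (w : W) {φ : FormalFun W b} {k : ℕ} {F : Poly V}
    (h : φ.val k = (AdicCompletion.of _ _ F).val k) :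
    (germ b w φ).val k = (AdicCompletion.of _ _ (polyGerm b w F)).val k := by
  rw [val_eq_iff_evalₐ_eq, AdicCompletion.evalₐ_of, ← germMod_eq b w h]
  exact AdicCompletion.evalₐ_liftAlgHom _ _ (factor_comp_germMod b w) k φ

lemma germ_of (w : W) (F : Poly V) :
    germ b w (AdicCompletion.of _ _ F) = AdicCompletion.of _ _ (polyGerm b w F) :=
  AdicCompletion.ext fun _ => germ_val_eq w rfl

lemma isAdicContinuous_germ (w : W) : IsAdicContinuous (germ b w) :=
  ⟨0, fun k φ ψ h => by
    obtain ⟨F, hF⟩ := exists_of_val_eq ψ k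
    exact (germ_val_eq w (h.trans hF)).trans (germ_val_eq w hF).symm⟩

lemma germ_inclusion_mul (h : pointStabilizer W b) (w : W) (φ : FormalFun W b) :
    germ b (Subgroup.inclusion (pointStabilizer_le W b) h * w) φ =
      formalAct (pointStabilizer W b) 0 h (germ b w φ) := by
  refine (isAdicContinuous_germ _).ext
    ((isAdicContinuous_extend _).comp (isAdicContinuous_germ w)) (fun F => ?_) φ
  rw [germ_of, germ_of, polyGerm_inclusion_mul]
  rfl

lemma germ_formalAct (u w : W) (φ : FormalFun W b) :
    germ b w (formalAct W b u φ) = germ b (w * u) φ := by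
  refine ((isAdicContinuous_germ w).comp (isAdicContinuous_extend _)).ext
    (isAdicContinuous_germ _) (fun F => ?_) φ
  rw [extend_of, germ_of, germ_of, polyGerm_apply, polyGerm_apply, Subgroup.coe_mul, polyAct_mul]
  rfl

lemma germ_ext {φ ψ : FormalFun W b} (h : ∀ w, germ b w φ = germ b w ψ) : φ = ψ := by
  rw [← sub_eq_zero]
  refine AdicCompletion.ext fun k => ?_
  obtain ⟨F, hF⟩ := exists_of_val_eq (φ - ψ) k
  rw [hF, AdicCompletion.val_zero_apply, of_val_eq_zero_iff, mem_orbitIdeal_pow_iff_polyGerm]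
  intro w
  rw [← of_val_eq_zero_iff, ← germ_val_eq w hF, map_sub, h, sub_self,
    AdicCompletion.val_zero_apply]

variable (W b) in
/-- The `W_b`-equivariant functions on `W` with values in `ℂ[[V]]`: these are the families of germs
of the functions on the formal neighbourhood of the orbit of `b`. -/
def germFamilies : Submodule ℂ (W → FormalFun (pointStabilizer W b) 0) where
  carrier := {q | ∀ h w, q (Subgroup.inclusion (pointStabilizer_le W b) h * w) =
    formalAct (pointStabilizer W b) 0 h (q w)}
  add_mem' hq hq' h w := by simp [hq h w, hq' h w]
  zero_mem' h w := by simp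
  smul_mem' t q hq h w := by simp [hq h w]

lemma exists_polyGerm_sub_mem {u : orbitPoints W b → W}
    (hu : ∀ p, (u p : V ≃ₗ[ℂ] V)⁻¹ b = p) (G : orbitPoints W b → Poly V) (k : ℕ) :
    ∃ F, ∀ p, polyGerm b (u p) F - G p ∈ orbitIdeal (pointStabilizer W b) (0 : V) ^ k := by
  obtain ⟨F, hF⟩ := Ideal.exists_forall_sub_mem_ideal
    (pairwise_isCoprime_pointIdeal_pow (orbitPoints W b) k)
    fun p => (polyGerm b (u p)).symm (G p)
  refine ⟨F, fun p => ?_⟩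
  rw [← (polyGerm b (u p)).apply_symm_apply (G p), ← map_sub, polyGerm_mem_pow_iff, hu]
  exact hF p

lemma exists_polyGerm_val_eq {q : W → FormalFun (pointStabilizer W b) 0}
    (hq : q ∈ germFamilies W b) (k : ℕ) :
    ∃ F : Poly V, ∀ w, (AdicCompletion.of _ _ (polyGerm b w F)).val k = (q w).val k := by
  choose u hu using fun p : orbitPoints W b => p.2
  choose G hG using fun p : orbitPoints W b => exists_of_val_eq (q (u p)) (k + 1)
  obtain ⟨F, hF⟩ := exists_polyGerm_sub_mem hu G (k + 1)
  refine ⟨F, fun w => ?_⟩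
  let p : orbitPoints W b := ⟨_, w, rfl⟩
  have hup : (q (u p)).val (k + 1) = (AdicCompletion.of _ _ (polyGerm b (u p) F)).val (k + 1) :=
    (hG p).trans (of_val_eq_of_val_iff.2 (hF p)).symm
  obtain ⟨h, hw⟩ := exists_inclusion_mul_eq (hu p).symm
  rw [← hw, hq, polyGerm_inclusion_mul]
  exact (congrArg (extendAux ⟨_, polyAct_mem_shiftOps _ 0 h⟩ k) hup).symm

lemma exists_germ_eq {q : W → FormalFun (pointStabilizer W b) 0} (hq : q ∈ germFamilies W b) :
    ∃ φ : FormalFun W b, ∀ w, germ b w φ = q w := by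
  choose F hF using exists_polyGerm_val_eq hq
  have hcompat {m n : ℕ} (hmn : m ≤ n) : (AdicCompletion.of (orbitIdeal W b) _ (F n)).val m =
      (AdicCompletion.of _ _ (F m)).val m := by
    rw [of_val_eq_of_val_iff, mem_orbitIdeal_pow_iff_polyGerm]
    intro w
    rw [map_sub, ← of_val_eq_of_val_iff, hF m w]
    exact val_eq_of_le hmn (hF n w)
  let φ : FormalFun W b := ⟨fun k => (AdicCompletion.of _ _ (F k)).val k,
    fun {m n} hmn => ((AdicCompletion.of _ _ (F n)).2 hmn).trans (hcompat hmn)⟩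
  refine ⟨φ, fun w => AdicCompletion.ext fun k => ?_⟩
  rw [germ_val_eq w (φ := φ) (k := k) (F := F k) rfl, hF]

end Germs

/-! ### Dunkl operators near a point -/

section NearPoint

lemma isUnit_formalLin_add (α : Dual ℂ V) {t : ℂ} (ht : t ≠ 0) :
    IsUnit (formalLin W 0 α + algebraMap ℂ _ t) := by
  have hmem : (-t⁻¹) • lin α ∈ orbitIdeal W (0 : V) :=
    Submodule.smul_of_tower_mem _ _ (by rw [orbitIdeal_zero, RingHom.mem_ker, evalAt_lin, map_zero])
  have heq : formalLin W 0 α + algebraMap ℂ _ t =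
      t • (1 - AdicCompletion.of (orbitIdeal W 0) _ ((-t⁻¹) • lin α)) := by
    rw [of_smul, smul_sub, smul_smul, mul_neg, mul_inv_cancel₀ ht, neg_one_smul, sub_neg_eq_add,
      add_comm, Algebra.algebraMap_eq_smul_one, formalLin]
  rw [heq, Algebra.smul_def]
  exact ((IsUnit.mk0 t ht).map _).mul (isUnit_one_sub_of hmem)

section

variable (r : Roots W) (c : reflections W → ℂ) (b : V)

/-- The coefficient of `s` in the Dunkl-Opdam operator of `a`, expanded at `b` for `s ∉ W_b`. -/
def poleCoeff (s : reflections W) (a : V) : FormalFun (pointStabilizer W b) 0 :=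
  (2 * c s / (1 - r.eig s)) • (r.root s a • invShifted W b (r.root s))

/-- The Dunkl-Opdam operator of `a` for `W_b`, in the completed algebra at the origin. -/
abbrev localDunklOp (a : V) : localCompletion r c b := completion.dunklOp _ _ 0 a

end

variable (r : Roots W) {b : V}

lemma polyShift_divDiff {s : reflections W} (hs : (s : V ≃ₗ[ℂ] V) b = b) (F : Poly V) :
    polyShift b (divDiff r s F) = divDiff r s (polyShift b F) := by
  apply mul_left_cancel₀ (lin_root_ne_zero r s)
  have hroot : polyShift b (lin (r.root s)) = lin (r.root s) := by
    rw [polyShift_lin, (reflection_apply_eq_self_iff r s b).1 hs, map_zero, add_zero]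
  have hact := polyShift_polyAct (s : V ≃ₗ[ℂ] V) b F
  rw [hs] at hact
  rw [root_mul_divDiff, ← hact, ← map_sub, ← root_mul_divDiff r, map_mul, hroot]

lemma root_apply_ne_zero {s : reflections W} (hs : (s : V ≃ₗ[ℂ] V) ∉ pointStabilizer W b) :
    r.root s b ≠ 0 := fun h => hs ⟨s.2.1, (reflection_apply_eq_self_iff r s b).2 h⟩

lemma of_polyShift_divDiff {s : reflections W} (hs : (s : V ≃ₗ[ℂ] V) ∉ pointStabilizer W b)
    (F : Poly V) :
    AdicCompletion.of (orbitIdeal (pointStabilizer W b) 0) _ (polyShift b (divDiff r s F)) =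
      invShifted W b (r.root s) * (AdicCompletion.of _ _
        (polyShift b (polyAct (s : V ≃ₗ[ℂ] V) F)) - AdicCompletion.of _ _ (polyShift b F)) := by
  have hu := isUnit_formalLin_add (W := pointStabilizer W b) (r.root s) (root_apply_ne_zero r hs)
  apply hu.mul_left_cancel
  rw [invShifted, ← mul_assoc, Ring.mul_inverse_cancel _ hu, one_mul, formalLin, ← of_algebraMap,
    ← map_add, ← polyShift_lin, ← of_mul, ← map_mul, root_mul_divDiff, map_sub, map_sub]

section

variable [Finite (reflections W)]

variable (W b) in
/-- The reflections of `W` that do not fix `b`. -/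
def farReflections : Finset (reflections W) :=
  (Set.toFinite {s : reflections W | (s : V ≃ₗ[ℂ] V) ∉ pointStabilizer W b}).toFinset

lemma mem_farReflections {s : reflections W} :
    s ∈ farReflections W b ↔ (s : V ≃ₗ[ℂ] V) ∉ pointStabilizer W b := by
  simp [farReflections]

lemma finite_reflections_pointStabilizer : Finite (reflections (pointStabilizer W b)) :=
  .of_injective _ (Set.inclusion_injective (reflections_mono (pointStabilizer_le W b)))

variable (c : reflections W → ℂ)

lemma dunkl_eq_dunkl_restrict_add (a : V) (F : Poly V) :
    dunkl r c a F = dunkl (r.restrict (pointStabilizer_le W b))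
        (restrictParam (pointStabilizer_le W b) c) a F +
      ∑ s ∈ farReflections W b, (2 * c s / (1 - r.eig s) * r.root s a) • divDiff r s F := by
  classical
  have := finite_reflections_pointStabilizer (W := W) (b := b)
  rw [dunkl_apply, dunkl_apply, add_assoc, ← Finset.sum_compl_add_sum (farReflections W b)]
  congr 2
  symm
  refine Finset.sum_of_injOn (Set.inclusion (reflections_mono (pointStabilizer_le W b)))
    (Set.inclusion_injective _).injOn (fun s _ => ?_) (fun s hs hs' => ?_) fun s _ => rfl
  · simpa [mem_farReflections] using s.2.1
  · rw [Finset.mem_compl, mem_farReflections, not_not] at hs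
    exact absurd ⟨⟨s, hs, s.2.2⟩, Finset.mem_coe.2 (Finset.mem_univ _), rfl⟩ hs'

lemma polyShift_dunkl (hb : ∀ s : reflections W, (s : V ≃ₗ[ℂ] V) b = b) (a : V) (F : Poly V) :
    polyShift b (dunkl r c a F) = dunkl r c a (polyShift b F) := by
  simp only [dunkl_apply, map_add, map_sum, map_smul, polyShift_deriv,
    fun s => polyShift_divDiff r (hb s)]

lemma of_polyShift_dunkl (a : V) (F : Poly V) :
    AdicCompletion.of (orbitIdeal (pointStabilizer W b) 0) _ (polyShift b (dunkl r c a F)) =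
      (localDunklOp r c b a).1 (AdicCompletion.of _ _ (polyShift b F)) +
      ∑ s ∈ farReflections W b, poleCoeff r c b s a * (AdicCompletion.of _ _
        (polyShift b (polyAct (s : V ≃ₗ[ℂ] V) F)) - AdicCompletion.of _ _ (polyShift b F)) := by
  have := finite_reflections_pointStabilizer (W := W) (b := b)
  have hb (s : reflections (pointStabilizer W b)) : (s : V ≃ₗ[ℂ] V) b = b := s.2.1.2
  rw [dunkl_eq_dunkl_restrict_add, map_add, map_add, polyShift_dunkl _ _ hb, dunklOp_of, map_sum,
    map_sum]
  congr 1
  refine Finset.sum_congr rfl fun s hs => ?_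
  rw [map_smul, of_smul, of_polyShift_divDiff r (mem_farReflections.1 hs), poleCoeff,
    mul_smul, smul_mul_assoc, smul_mul_assoc]

end

variable {c : reflections W → ℂ}

lemma germ_dunklOp [Finite W] (hc : IsInvariant c) (a : V) (w : W) (φ : FormalFun W b) :
    germ b w ((completion.dunklOp r c b a).1 φ) =
      (localDunklOp r c b ((w : V ≃ₗ[ℂ] V) a)).1 (germ b w φ) +
      ∑ s ∈ farReflections W b, poleCoeff r c b s ((w : V ≃ₗ[ℂ] V) a) *
        (germ b (⟨s, s.2.1⟩ * w) φ - germ b w φ) := by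
  have hlhs : IsAdicContinuous fun φ => germ b w ((completion.dunklOp r c b a).1 φ) :=
    (isAdicContinuous_germ w).comp
      (isAdicContinuous_of_mem_completion (completion.dunklOp r c b a).2)
  have hlocal : IsAdicContinuous fun φ =>
      (localDunklOp r c b ((w : V ≃ₗ[ℂ] V) a)).1 (germ b w φ) :=
    (isAdicContinuous_of_mem_completion (localDunklOp r c b _).2).comp (isAdicContinuous_germ w)
  have hdiff (s : reflections W) := (isAdicContinuous_germ (b := b) (⟨s, s.2.1⟩ * w)).sub
    (isAdicContinuous_germ w)
  have hpole := IsAdicContinuous.sum (farReflections W b) fun s =>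
    (IsAdicContinuous.const (poleCoeff r c b s ((w : V ≃ₗ[ℂ] V) a))).mul (hdiff s)
  refine hlhs.ext (hlocal.add hpole) (fun F => ?_) φ
  simp only [dunklOp_of _ F, germ_of, polyGerm_apply, polyAct_dunkl r hc, of_polyShift_dunkl,
    Subgroup.coe_mul, polyAct_mul, AlgHom.comp_apply]

end NearPoint

/-! ### Rigidity of the completed algebra -/

section Rigidity

variable {r : Roots W} {c : reflections W → ℂ} {b : V}

lemma completion_induction {S : Subalgebra ℂ (completion r c b)}
    (hfunc : ∀ φ, completion.func r c b φ ∈ S) (hgrp : ∀ w, completion.grp r c b w ∈ S)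
    (hdunkl : ∀ a, completion.dunklOp r c b a ∈ S) (T : completion r c b) : T ∈ S := by
  have hle : completion r c b ≤ S.map (completion r c b).val := by
    refine Algebra.adjoin_le ?_
    rintro _ ((⟨φ, rfl⟩ | ⟨w, rfl⟩) | ⟨a, rfl⟩)
    exacts [⟨_, hfunc φ, rfl⟩, ⟨_, hgrp w, rfl⟩, ⟨_, hdunkl a, rfl⟩]
  obtain ⟨T', hT', h⟩ := hle T.2
  exact Subtype.ext h ▸ hT'

lemma completion_algHom_ext {Z : Type*} [Semiring Z] [Algebra ℂ Z]
    {Φ Ψ : completion r c b →ₐ[ℂ] Z}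
    (hfunc : ∀ φ, Φ (completion.func r c b φ) = Ψ (completion.func r c b φ))
    (hgrp : ∀ w, Φ (completion.grp r c b w) = Ψ (completion.grp r c b w))
    (hdunkl : ∀ a, Φ (completion.dunklOp r c b a) = Ψ (completion.dunklOp r c b a)) : Φ = Ψ :=
  AlgHom.ext fun T =>
    completion_induction (S := AlgHom.equalizer Φ Ψ) hfunc hgrp hdunkl T

variable (r c b) in
/-- The functions on the formal neighbourhood of the orbit of `b`, as a commutative subalgebra of
the completed algebra. -/
def funcHom : FormalFun W b →ₐ[ℂ] completion r c b :=
  (Algebra.lmul ℂ (FormalFun W b)).codRestrict (completion r c b)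
    fun φ => (completion.func r c b φ).2

variable (r c b) in
/-- The polynomial functions, as a commutative subalgebra of the completed algebra. -/
def polyHom : Poly V →ₐ[ℂ] completion r c b :=
  (funcHom r c b).comp (IsScalarTower.toAlgHom ℂ (Poly V) (FormalFun W b))

lemma polyHom_mem {S : Subalgebra ℂ (completion r c b)}
    (hS : ∀ α, completion.func r c b (formalLin W b α) ∈ S) (F : Poly V) :
    polyHom r c b F ∈ S := by
  induction F using SymmetricAlgebra.induction with
  | algebraMap t => rw [AlgHom.commutes]; exact S.algebraMap_mem t
  | ι α => exact hS α
  | mul F G hF hG => rw [map_mul]; exact S.mul_mem hF hG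
  | add F G hF hG => rw [map_add]; exact S.add_mem hF hG

lemma polyHom_mul_apply (F : Poly V) (T : completion r c b) (ψ : FormalFun W b) :
    (polyHom r c b F * T).1 ψ = F • T.1 ψ :=
  (Algebra.smul_def F (T.1 ψ)).symm

lemma funcHom_smul (F : Poly V) (φ : FormalFun W b) :
    funcHom r c b (F • φ) = polyHom r c b F * funcHom r c b φ :=
  (congrArg (funcHom r c b) (Algebra.smul_def F φ)).trans (map_mul (funcHom r c b) _ _)

lemma eq_func_of_commute {T : completion r c b}
    (hT : ∀ α, Commute T (completion.func r c b (formalLin W b α))) :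
    T = completion.func r c b (T.1 1) := by
  have hpoly (F : Poly V) : polyHom r c b F * T = T * polyHom r c b F :=
    Subalgebra.mem_centralizer_iff ℂ |>.1 (polyHom_mem (S := .centralizer ℂ {T})
      (fun α => Subalgebra.mem_centralizer_iff ℂ |>.2 fun _ h => h ▸ (hT α).eq) F) T rfl |>.symm
  refine completion_ext fun F => ?_
  have hF : T.1 (AdicCompletion.of _ _ F * 1) = AdicCompletion.of _ _ F * T.1 1 :=
    LinearMap.congr_fun (congrArg Subtype.val (hpoly F).symm) 1
  rw [mul_one] at hF
  exact hF.trans (mul_comm _ _)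

variable [FiniteDimensional ℂ V]

instance isNoetherianRing_poly : IsNoetherianRing (Poly V) :=
  isNoetherianRing_of_ringEquiv _
    (SymmetricAlgebra.equivMvPolynomial (finBasis ℂ (Dual ℂ V))).symm.toRingEquiv

lemma apply_func_eq_of_fixes_formalLin (Φ : completion r c b →ₐ[ℂ] completion r c b)
    (hx : ∀ α, Φ (completion.func r c b (formalLin W b α)) =
      completion.func r c b (formalLin W b α)) (φ : FormalFun W b) :
    Φ (completion.func r c b φ) = completion.func r c b φ := by
  have hpoly (F : Poly V) : Φ (polyHom r c b F) = polyHom r c b F :=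
    polyHom_mem (S := AlgHom.equalizer Φ (AlgHom.id ℂ _)) hx F
  let η : FormalFun W b →ₗ[Poly V] FormalFun W b :=
    { toFun φ := (Φ (funcHom r c b φ)).1 1
      map_add' φ ψ := by rw [map_add, map_add]; rfl
      map_smul' F φ := by rw [funcHom_smul, map_mul, hpoly, polyHom_mul_apply, RingHom.id_apply] }
  have hη (φ : FormalFun W b) : Φ (completion.func r c b φ) = completion.func r c b (η φ) := by
    refine eq_func_of_commute fun α => ?_
    rw [← hx α]
    exact ((Commute.all φ (formalLin W b α)).map (funcHom r c b)).map Φ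
  have hη_of (F : Poly V) : η (AdicCompletion.of _ _ F) = AdicCompletion.of _ _ F :=
    (DFunLike.congr_fun (congrArg Subtype.val (hpoly F)) 1).trans (mul_one _)
  rw [hη, (IsAdicContinuous.of_linearMap (Ideal.fg_of_isNoetherianRing _) η).ext .id hη_of φ]

lemma algEquiv_ext_of_generators {Z : Type*} [Semiring Z] [Algebra ℂ Z]
    {θ θ' : completion r c b ≃ₐ[ℂ] Z}
    (hgrp : ∀ w, θ (completion.grp r c b w) = θ' (completion.grp r c b w))
    (hx : ∀ α, θ (completion.func r c b (formalLin W b α)) =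
      θ' (completion.func r c b (formalLin W b α)))
    (hdunkl : ∀ a, θ (completion.dunklOp r c b a) = θ' (completion.dunklOp r c b a)) :
    θ = θ' := by
  have hid : (θ.trans θ'.symm).toAlgHom = AlgHom.id ℂ (completion r c b) :=
    completion_algHom_ext
      (apply_func_eq_of_fixes_formalLin _ fun α => θ'.symm_apply_eq.2 (hx α))
      (fun w => θ'.symm_apply_eq.2 (hgrp w)) fun a => θ'.symm_apply_eq.2 (hdunkl a)
  exact AlgEquiv.ext fun T => θ'.symm_apply_eq.1 (DFunLike.congr_fun hid T)

end Rigidity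

/-! ### Algebras of operators and centralizer algebras -/

section GermSystem

variable {G H A E M : Type*} [Group G] [Group H] [Ring A] [AddCommGroup E]
  [Module A E] [AddCommGroup M] [Module ℂ M] {i : H →* G} {j : H →* A}

lemma extend_zero_mul (hi : Function.Injective i) (h : H) (g : G) :
    Function.extend i j 0 (i h * g) = j h * Function.extend i j 0 g := by
  by_cases hg : ∃ k, i k = g
  · obtain ⟨k, rfl⟩ := hg
    rw [← map_mul, hi.extend_apply, hi.extend_apply, map_mul]
  · rw [Function.extend_apply' _ _ g hg, Function.extend_apply', Pi.zero_apply, Pi.zero_apply,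
      mul_zero]
    rintro ⟨k, hk⟩
    exact hg ⟨h⁻¹ * k, by rw [map_mul, map_inv, hk, inv_mul_cancel_left]⟩

lemma sum_extend_zero_smul [Fintype G] (hi : Function.Injective i) {q : G → E}
    (hq : ∀ h g, q (i h * g) = j h • q g) (w : G) :
    ∑ g, Function.extend i j 0 (w * g⁻¹) • q g = Nat.card H • q w := by
  have : Finite H := .of_injective i hi
  have := Fintype.ofFinite H
  rw [Nat.card_eq_fintype_card, ← Finset.card_univ, ← Finset.sum_const]
  symm
  refine Fintype.sum_of_injective (fun h => (i h)⁻¹ * w)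
    ((mul_left_injective w).comp (inv_injective.comp hi)) _ _ (fun g hg => ?_) fun h => ?_
  · rw [Function.extend_apply', Pi.zero_apply, zero_smul]
    rintro ⟨h, hh⟩
    exact hg ⟨h, by simp [hh]⟩
  · rw [mul_inv_rev, inv_inv, mul_inv_cancel_left, hi.extend_apply, ← hq, mul_inv_cancel_left]

variable (j) in
/-- The element of `Fun_H(G, A)` supported on `H g` with value `1` at `g`. Right translates of
these by elements of `A` span `Fun_H(G, A)`. -/
def deltaFun (hi : Function.Injective i) (g : G) : funH i j :=
  ⟨fun w => Function.extend i j 0 (w * g⁻¹),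
    fun h _ => (congrArg _ (mul_assoc _ _ _)).trans (extend_zero_mul hi h _)⟩

lemma sum_smul_deltaFun [Fintype G] (hi : Function.Injective i) (f : funH i j) :
    ∑ g, MulOpposite.op (f.1 g) • deltaFun j hi g = Nat.card H • f := by
  refine Subtype.ext (funext fun w => ?_)
  rw [AddSubmonoidClass.coe_finsetSum, Finset.sum_apply]
  exact sum_extend_zero_smul (j := j) (q := f.1) hi f.2 w

/-- An identification of `M` with the space of functions `q : G → E` such that
`q (h g) = h • q g` for `h` in `H`; the value of the function of `m` at `g` is `germ g m`. -/
structure GermSystem (i : H →* G) (j : H →* A) (E M : Type*) [AddCommGroup E] [Module ℂ E]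
    [Module A E] [AddCommGroup M] [Module ℂ M] where
  germ : G → M →ₗ[ℂ] E
  germ_mul : ∀ h g m, germ (i h * g) m = j h • germ g m
  ext : ∀ m m', (∀ g, germ g m = germ g m') → m = m'
  exists_germ : ∀ q : G → E, (∀ h g, q (i h * g) = j h • q g) → ∃ m, ∀ g, germ g m = q g

namespace GermSystem

variable [Module ℂ E] (D : GermSystem i j E M)

lemma exists_germ_eq_smul (f : funH i j) (ψ : E) : ∃ m, ∀ g, D.germ g m = f.1 g • ψ :=
  D.exists_germ _ fun h g => by rw [f.2 h g, mul_smul]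

/-- The element of `M` with germs `f g • ψ`. -/
def glue (f : funH i j) (ψ : E) : M := (D.exists_germ_eq_smul f ψ).choose

lemma germ_glue (f : funH i j) (ψ : E) (g : G) : D.germ g (D.glue f ψ) = f.1 g • ψ :=
  (D.exists_germ_eq_smul f ψ).choose_spec g

lemma glue_op_smul (a : A) (f : funH i j) (ψ : E) :
    D.glue (MulOpposite.op a • f) ψ = D.glue f (a • ψ) :=
  D.ext _ _ fun g => by rw [germ_glue, germ_glue]; exact mul_smul (f.1 g) a ψ

lemma glue_add (f f' : funH i j) (ψ : E) : D.glue (f + f') ψ = D.glue f ψ + D.glue f' ψ :=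
  D.ext _ _ fun g => by
    rw [map_add, germ_glue, germ_glue, germ_glue]; exact add_smul (f.1 g) (f'.1 g) ψ

lemma sum_glue_deltaFun [Fintype G] (hi : Function.Injective i) (m : M) :
    ∑ g, D.glue (deltaFun j hi g) (D.germ g m) = Nat.card H • m := by
  refine D.ext _ _ fun w => ?_
  rw [map_sum, map_nsmul,
    ← sum_extend_zero_smul (q := fun g => D.germ g m) hi (fun h g => D.germ_mul h g m) w]
  exact Finset.sum_congr rfl fun g _ => D.germ_glue _ _ w

/-- `T` acts on the germ at `1` by `a`, and takes values supported on `H`. -/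
def IsCorner (T : Module.End ℂ M) (a : A) : Prop :=
  (∀ m, D.germ 1 (T m) = a • D.germ 1 m) ∧ ∀ g ∉ Set.range i, ∀ m, D.germ g (T m) = 0

variable {D} in
lemma IsCorner.germ_eq (hi : Function.Injective i) {T : Module.End ℂ M} {a : A}
    (h : D.IsCorner T a) (w : G) (m : M) :
    D.germ w (T m) = Function.extend i j 0 w • a • D.germ 1 m := by
  by_cases hw : ∃ k, i k = w
  · obtain ⟨k, rfl⟩ := hw
    rw [hi.extend_apply, ← h.1, ← D.germ_mul, mul_one]
  · rw [h.2 w hw, Function.extend_apply' _ _ w hw, Pi.zero_apply, zero_smul]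

/-- `S` acts on equivariant families of operators as `T` acts on `M`. -/
def Intertwines (T : Module.End ℂ M) (S : centralizerAlg i j) : Prop :=
  ∀ f ψ, D.glue (S f) ψ = T (D.glue f ψ)

variable {D} {T T' : Module.End ℂ M} {S S' : centralizerAlg i j}

namespace Intertwines

lemma apply_smul (h : D.Intertwines T S) (f : funH i j) (g : G) (ψ : E) :
    (S f).1 g • ψ = D.germ g (T (D.glue f ψ)) := by
  rw [← h f ψ, germ_glue]

lemma one : D.Intertwines 1 1 := fun _ _ => rfl

lemma add (h : D.Intertwines T S) (h' : D.Intertwines T' S') :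
    D.Intertwines (T + T') (S + S') :=
  fun f ψ => by rw [LinearMap.add_apply, LinearMap.add_apply, glue_add, h, h']

lemma mul (h : D.Intertwines T S) (h' : D.Intertwines T' S') :
    D.Intertwines (T * T') (S * S') :=
  fun f ψ => by rw [Module.End.mul_apply, Module.End.mul_apply, h, h']

lemma left_unique [Finite G] (hi : Function.Injective i) (h : D.Intertwines T S)
    (h' : D.Intertwines T' S) : T = T' := by
  have := Fintype.ofFinite G
  have : Finite H := .of_injective i hi
  refine LinearMap.ext fun m => smul_right_injective M (Nat.cast_ne_zero.2 Nat.card_pos.ne' :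
    (Nat.card H : ℂ) ≠ 0) ?_
  simp only [Nat.cast_smul_eq_nsmul, ← map_nsmul, ← D.sum_glue_deltaFun hi m, map_sum]
  exact Finset.sum_congr rfl fun g _ => (h _ _).symm.trans (h' _ _)

lemma right_unique [FaithfulSMul A E] (h : D.Intertwines T S) (h' : D.Intertwines T S') : S = S' :=
  LinearMap.ext fun f => Subtype.ext <| funext fun g => FaithfulSMul.eq_of_smul_eq_smul fun ψ : E =>
    (h.apply_smul f g ψ).trans (h'.apply_smul f g ψ).symm

end Intertwines

lemma exists_intertwines [FaithfulSMul A E]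
    (hT : ∀ f g, ∃ a : A, ∀ ψ, a • ψ = D.germ g (T (D.glue f ψ))) :
    ∃ S, D.Intertwines T S := by
  choose F hF using hT
  have ext {f f' : funH i j} (h : ∀ ψ, D.glue f ψ = D.glue f' ψ) : f = f' :=
    Subtype.ext <| funext fun g => FaithfulSMul.eq_of_smul_eq_smul fun ψ : E => by
      rw [← D.germ_glue, h, germ_glue]
  have hmem (f : funH i j) : F f ∈ funH i j := fun h g =>
    FaithfulSMul.eq_of_smul_eq_smul fun ψ : E => by rw [hF, D.germ_mul, mul_smul, ← hF]
  have hglue (f : funH i j) (ψ : E) : D.glue ⟨F f, hmem f⟩ ψ = T (D.glue f ψ) :=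
    D.ext _ _ fun g => by rw [germ_glue, hF]
  refine ⟨{ toFun f := ⟨F f, hmem f⟩, map_add' f f' := ext fun ψ => ?_,
            map_smul' a f := ext fun ψ => ?_ }, hglue⟩
  · rw [glue_add, hglue, hglue, hglue, glue_add, map_add]
  · obtain ⟨a, rfl⟩ := MulOpposite.op_surjective a
    rw [RingHom.id_apply, glue_op_smul, hglue, hglue, glue_op_smul]

variable [Algebra ℂ A] [IsScalarTower ℂ A E]

variable (D) in
lemma glue_smul (t : ℂ) (f : funH i j) (ψ : E) : D.glue (t • f) ψ = t • D.glue f ψ :=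
  D.ext _ _ fun g => by rw [map_smul, germ_glue, germ_glue]; exact smul_assoc t (f.1 g) ψ

lemma Intertwines.smul (h : D.Intertwines T S) (t : ℂ) : D.Intertwines (t • T) (t • S) :=
  fun f ψ => by rw [LinearMap.smul_apply, LinearMap.smul_apply, glue_smul, h]

lemma Intertwines.algebraMap (t : ℂ) : D.Intertwines (algebraMap ℂ _ t) (algebraMap ℂ _ t) := by
  rw [Algebra.algebraMap_eq_smul_one, Algebra.algebraMap_eq_smul_one]
  exact one.smul t

variable (D) in
/-- The operators on `M` that come from the centralizer algebra. -/
def centralizing : Subalgebra ℂ (Module.End ℂ M) where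
  carrier := {T | ∃ S, D.Intertwines T S}
  mul_mem' := fun ⟨S, hS⟩ ⟨S', hS'⟩ => ⟨S * S', hS.mul hS'⟩
  add_mem' := fun ⟨S, hS⟩ ⟨S', hS'⟩ => ⟨S + S', hS.add hS'⟩
  algebraMap_mem' t := ⟨_, .algebraMap t⟩

variable (D) in
/-- The element of the centralizer algebra that acts as a given operator. -/
def centralizerHom [FaithfulSMul A E] : D.centralizing →ₐ[ℂ] centralizerAlg i j :=
  have spec (T : D.centralizing) : D.Intertwines T.1 T.2.choose := T.2.choose_spec
  { toFun T := T.2.choose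
    map_one' := (spec 1).right_unique .one
    map_mul' T T' := (spec (T * T')).right_unique ((spec T).mul (spec T'))
    map_zero' := (spec 0).right_unique fun f ψ => by simpa using D.glue_smul 0 f ψ
    map_add' T T' := (spec (T + T')).right_unique ((spec T).add (spec T'))
    commutes' t := (spec _).right_unique (.algebraMap t) }

lemma intertwines_centralizerHom [FaithfulSMul A E] (T : D.centralizing) :
    D.Intertwines T.1 (D.centralizerHom T) :=
  T.2.choose_spec

variable (D) in
/-- The elements of `A` by which some operator in `B`, with values supported on `H`, acts on germs
at `1`. -/
def corners (B : Subalgebra ℂ (Module.End ℂ M)) : NonUnitalSubalgebra ℂ A where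
  carrier := {a | ∃ T ∈ B, D.IsCorner T a}
  zero_mem' := ⟨0, zero_mem B, by simp [IsCorner]⟩
  add_mem' := by
    rintro a a' ⟨T, hT, h⟩ ⟨T', hT', h'⟩
    refine ⟨T + T', add_mem hT hT', fun m => ?_, fun g hg m => ?_⟩
    · rw [LinearMap.add_apply, map_add, h.1, h'.1, add_smul]
    · rw [LinearMap.add_apply, map_add, h.2 g hg, h'.2 g hg, add_zero]
  mul_mem' := by
    rintro a a' ⟨T, hT, h⟩ ⟨T', hT', h'⟩
    refine ⟨T * T', mul_mem hT hT', fun m => ?_, fun g hg m => ?_⟩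
    · rw [Module.End.mul_apply, h.1, h'.1, mul_smul]
    · rw [Module.End.mul_apply, h.2 g hg]
  smul_mem' := by
    rintro t a ⟨T, hT, h⟩
    refine ⟨t • T, B.smul_mem hT t, fun m => ?_, fun g hg m => ?_⟩
    · rw [LinearMap.smul_apply, map_smul, h.1, smul_assoc]
    · rw [LinearMap.smul_apply, map_smul, h.2 g hg, smul_zero]

variable {B : Subalgebra ℂ (Module.End ℂ M)} {ρ : G →* B}

-- The operators `ρ g⁻¹ * T * ρ g'`, with `T` a corner, play the role of matrix units.
lemma exists_intertwines_card_smul [Finite G] (hi : Function.Injective i)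
    (hρ : ∀ u g m, D.germ g ((ρ u).1 m) = D.germ (g * u) m)
    (hA : ∀ a : A, a ∈ D.corners B) (S : centralizerAlg i j) :
    ∃ T ∈ B, D.Intertwines T (Nat.card H • Nat.card H • S) := by
  have := Fintype.ofFinite G
  choose C hC hcorner using hA
  let a (g g' : G) : A := (S (deltaFun j hi g')).1 g
  let T (g g' : G) : B := ρ g⁻¹ * ⟨C (a g g'), hC _⟩ * ρ g'
  have germ_T (w g g' : G) (m : M) : D.germ w ((T g g').1 m) =
      Function.extend i j 0 (w * g⁻¹) • a g g' • D.germ g' m := by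
    change D.germ w ((ρ g⁻¹).1 (C (a g g') ((ρ g').1 m))) = _
    rw [hρ, (hcorner _).germ_eq hi, hρ, one_mul]
  have sum_a (f : funH i j) (g : G) : ∑ g', a g g' * f.1 g' = Nat.card H • (S f).1 g := by
    have hS : ∑ g', MulOpposite.op (f.1 g') • S (deltaFun j hi g') = Nat.card H • S f := by
      simp only [← map_smul, ← map_sum, sum_smul_deltaFun, map_nsmul]
    have hg := congrFun (congrArg Subtype.val hS) g
    rwa [AddSubmonoidClass.coe_finsetSum, Finset.sum_apply] at hg
  refine ⟨(∑ g, ∑ g', T g g' : B), SetLike.coe_mem _, fun f ψ => D.ext _ _ fun w => ?_⟩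
  let q (g : G) : E := (Nat.card H • (S f).1 g) • ψ
  have hq (h : H) (g : G) : q (i h * g) = j h • q g := by
    simp only [q, (S f).2 h g, smul_smul, mul_smul_comm]
  calc D.germ w (D.glue ((Nat.card H • Nat.card H • S) f) ψ)
      = Nat.card H • q w :=
        (D.germ_glue _ _ _).trans (smul_assoc (Nat.card H) (Nat.card H • (S f).1 w) ψ)
    _ = ∑ g, Function.extend i j 0 (w * g⁻¹) • q g := (sum_extend_zero_smul hi hq w).symm
    _ = ∑ g, ∑ g', Function.extend i j 0 (w * g⁻¹) • a g g' • f.1 g' • ψ := by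
      simp only [q, ← sum_a, Finset.sum_smul, Finset.smul_sum, mul_smul]
    _ = D.germ w ((∑ g, ∑ g', T g g' : B).1 (D.glue f ψ)) := by
      simp only [AddSubmonoidClass.coe_finsetSum, LinearMap.sum_apply, map_sum, germ_T, germ_glue]

theorem bijective_centralizerHom_comp_inclusion [Finite G] [FaithfulSMul A E]
    (hi : Function.Injective i) (hρ : ∀ u g m, D.germ g ((ρ u).1 m) = D.germ (g * u) m)
    (hA : ∀ a : A, a ∈ D.corners B) (hB : B ≤ D.centralizing) :
    Function.Bijective (D.centralizerHom.comp (Subalgebra.inclusion hB)) := by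
  have : Finite H := .of_injective i hi
  have hcard : (Nat.card H : ℂ) ≠ 0 := Nat.cast_ne_zero.2 Nat.card_pos.ne'
  refine ⟨fun T T' h => Subtype.ext ?_, fun S => ?_⟩
  · refine (intertwines_centralizerHom ⟨T, hB T.2⟩).left_unique hi ?_
    exact h ▸ intertwines_centralizerHom ⟨T', hB T'.2⟩
  · obtain ⟨T, hT, hTS⟩ := exists_intertwines_card_smul hi hρ hA S
    have hS : S = (Nat.card H : ℂ)⁻¹ • (Nat.card H : ℂ)⁻¹ • Nat.card H • Nat.card H • S := by
      simp only [← Nat.cast_smul_eq_nsmul ℂ, smul_comm (Nat.card H : ℂ)⁻¹ (Nat.card H : ℂ),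
        smul_inv_smul₀ hcard]
    refine ⟨⟨_, B.smul_mem (B.smul_mem hT (Nat.card H : ℂ)⁻¹) (Nat.card H : ℂ)⁻¹⟩, ?_⟩
    rw [hS]
    exact (intertwines_centralizerHom _).right_unique ((hTS.smul _).smul _)

end GermSystem

end GermSystem

/-! ### The isomorphism `θ` -/

section Theta

variable (r : Roots W) (c : reflections W → ℂ) (b : V)

/-- The group `W_b` in the completed algebra at the origin. -/
abbrev localGrp : pointStabilizer W b →* localCompletion r c b := completion.grp _ _ 0

/-- Functions on the formal neighbourhood of the orbit of `b`, as `W_b`-equivariant families of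
power series indexed by `W`. -/
def orbitGerms [Finite W] :
    GermSystem (Subgroup.inclusion (pointStabilizer_le W b)) (localGrp r c b)
      (FormalFun (pointStabilizer W b) 0) (FormalFun W b) where
  germ w := (germ b w).toLinearMap
  germ_mul := germ_inclusion_mul
  ext _ _ := germ_ext
  exists_germ _ := exists_germ_eq

/-- The family by which `θ(y_a)` sends `f`. -/
def dunklFamily (a : V) (f : W → localCompletion r c b) (w : W) : localCompletion r c b :=
  localDunklOp r c b (w.1 a) * f w +
    ∑ᶠ (s : reflections W) (_ : s.1 ∉ pointStabilizer W b),
      (2 * c s / (1 - r.eig s)) •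
        (completion.func _ _ 0 (r.root s (w.1 a) • invShifted W b (r.root s)) *
          (f (⟨s.1, s.2.1⟩ * w) - f w))

variable {r c b}

lemma IsInvariant.restrictParam {W' : Subgroup (V ≃ₗ[ℂ] V)} (hc : IsInvariant c) (h : W' ≤ W) :
    IsInvariant (restrictParam h c) :=
  fun _ _ w hw e => hc _ _ w (h hw) e

lemma func_add_algebraMap (φ : FormalFun W b) (t : ℂ) :
    completion.func r c b (φ + algebraMap ℂ _ t) =
      completion.func r c b φ + algebraMap ℂ _ t :=
  (map_add (funcHom r c b) φ _).trans
    (congrArg (completion.func r c b φ + ·) ((funcHom r c b).commutes t))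

lemma func_smul (t : ℂ) (φ : FormalFun W b) :
    completion.func r c b (t • φ) = t • completion.func r c b φ := map_smul (funcHom r c b) t φ

lemma func_one : completion.func r c b 1 = 1 := map_one (funcHom r c b)

lemma notMem_range_inclusion_iff {w : W} :
    w ∉ Set.range (Subgroup.inclusion (pointStabilizer_le W b)) ↔
      (w : V ≃ₗ[ℂ] V) ∉ pointStabilizer W b :=
  not_congr ⟨by rintro ⟨h, rfl⟩; exact h.2, fun hw => ⟨⟨w, hw⟩, rfl⟩⟩

variable [Finite W]

lemma germ_formalLin (w : W) (α : Dual ℂ V) :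
    germ b w (formalLin W b α) = formalLin (pointStabilizer W b) 0 (dualAct (w : V ≃ₗ[ℂ] V) α) +
      algebraMap ℂ _ (dualAct (w : V ≃ₗ[ℂ] V) α b) := by
  rw [formalLin, germ_of, polyGerm_apply, polyAct_lin, polyShift_lin, map_add, of_algebraMap]
  rfl

lemma dunklFamily_eq_add_sum (a : V) (f : W → localCompletion r c b) (w : W) :
    dunklFamily r c b a f w = localDunklOp r c b (w.1 a) * f w +
      ∑ s ∈ farReflections W b, completion.func _ _ 0 (poleCoeff r c b s (w.1 a)) *
        (f (⟨s, s.2.1⟩ * w) - f w) := by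
  refine congrArg (_ + ·) ((finsum_mem_eq_finite_toFinset_sum _ (Set.toFinite
    {s : reflections W | (s : V ≃ₗ[ℂ] V) ∉ pointStabilizer W b})).trans
      (Finset.sum_congr rfl fun s _ => ?_))
  simp only [poleCoeff, func_smul, smul_mul_assoc]

lemma dunklFamily_smul (hc : IsInvariant c) {a : V} {f : W → localCompletion r c b}
    {ψ : FormalFun (pointStabilizer W b) 0} {φ : FormalFun W b}
    (hφ : ∀ w, germ b w φ = f w • ψ) (w : W) :
    dunklFamily r c b a f w • ψ = germ b w ((completion.dunklOp r c b a).1 φ) := by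
  rw [germ_dunklOp r hc, dunklFamily_eq_add_sum, add_smul, mul_smul, Finset.sum_smul]
  refine congrArg₂ (· + ·) (by rw [hφ]; rfl) (Finset.sum_congr rfl fun s _ => ?_)
  rw [hφ, hφ, mul_smul, sub_smul]
  rfl

lemma completion_le_centralizing (hc : IsInvariant c) :
    completion r c b ≤ (orbitGerms r c b).centralizing := by
  refine Algebra.adjoin_le ?_
  rintro _ ((⟨φ, rfl⟩ | ⟨u, rfl⟩) | ⟨a, rfl⟩) <;>
    refine GermSystem.exists_intertwines fun f w => ?_
  · refine ⟨completion.func _ _ 0 (germ b w φ) * f.1 w, fun ψ => ?_⟩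
    rw [mul_smul, ← (orbitGerms r c b).germ_glue]
    exact (map_mul (germ b w) _ _).symm
  · refine ⟨f.1 (w * u), fun ψ => ?_⟩
    rw [← (orbitGerms r c b).germ_glue]
    exact (germ_formalAct u w _).symm
  · exact ⟨dunklFamily r c b a f.1 w, fun ψ =>
      dunklFamily_smul hc ((orbitGerms r c b).germ_glue f ψ) w⟩

lemma exists_germ_supported (ψ : FormalFun (pointStabilizer W b) 0) :
    ∃ φ : FormalFun W b, germ b 1 φ = ψ ∧
      ∀ w : W, (w : V ≃ₗ[ℂ] V) ∉ pointStabilizer W b → germ b w φ = 0 := by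
  let i := Subgroup.inclusion (pointStabilizer_le W b)
  have hi : Function.Injective i := Subgroup.inclusion_injective _
  let T : W → Module.End ℂ (FormalFun (pointStabilizer W b) 0) :=
    Function.extend i (formalAct (pointStabilizer W b) 0) 0
  have hT_one : T 1 = 1 := (congrArg T (map_one i)).symm.trans <|
    (hi.extend_apply _ _ 1).trans (map_one _)
  have hT_zero (w : W) (hw : (w : V ≃ₗ[ℂ] V) ∉ pointStabilizer W b) : T w = 0 :=
    Function.extend_apply' _ _ _ (notMem_range_inclusion_iff.2 hw)
  obtain ⟨φ, hφ⟩ := exists_germ_eq (q := fun w => T w ψ) fun h w =>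
    DFunLike.congr_fun (extend_zero_mul hi h w) ψ
  exact ⟨φ, by rw [hφ, hT_one, Module.End.one_apply],
    fun w hw => by rw [hφ, hT_zero w hw, LinearMap.zero_apply]⟩

lemma germ_dunklOp_mul_of_supported (hc : IsInvariant c) {e : FormalFun W b}
    (he : germ b 1 e = 1)
    (he' : ∀ w : W, (w : V ≃ₗ[ℂ] V) ∉ pointStabilizer W b → germ b w e = 0)
    (a : V) (φ : FormalFun W b) :
    germ b 1 ((completion.dunklOp r c b a).1 (e * φ)) +
        (∑ s ∈ farReflections W b, poleCoeff r c b s a) * germ b 1 φ =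
      (localDunklOp r c b a).1 (germ b 1 φ) := by
  have hfar : ∀ s ∈ farReflections W b, poleCoeff r c b s a *
      (germ b (⟨s, s.2.1⟩ * 1) (e * φ) - germ b 1 φ) = -(poleCoeff r c b s a * germ b 1 φ) := by
    intro s hs
    rw [map_mul, he' _ (by simpa using mem_farReflections.1 hs), zero_mul, zero_sub, mul_neg]
  have h1 : ((1 : W) : V ≃ₗ[ℂ] V) a = a := rfl
  rw [germ_dunklOp r hc, map_mul (germ b 1), he, one_mul, h1, Finset.sum_congr rfl hfar,
    Finset.sum_neg_distrib, ← Finset.sum_mul, neg_add_cancel_right]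

lemma func_mem_corners (ψ : FormalFun (pointStabilizer W b) 0) :
    completion.func _ _ 0 ψ ∈ (orbitGerms r c b).corners (completion r c b) := by
  obtain ⟨χ, hχ, hχ'⟩ := exists_germ_supported (W := W) ψ
  refine ⟨_, (completion.func r c b χ).2, fun φ => ?_, fun w hw φ => ?_⟩
  · exact (map_mul (germ b 1) χ φ).trans (congrArg (· * germ b 1 φ) hχ)
  · refine (map_mul (germ b w) χ φ).trans ?_
    rw [hχ' w (notMem_range_inclusion_iff.1 hw), zero_mul]

lemma localGrp_mem_corners (u : pointStabilizer W b) :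
    localGrp r c b u ∈ (orbitGerms r c b).corners (completion r c b) := by
  obtain ⟨e, he, he'⟩ := exists_germ_supported (W := W) (b := b) 1
  refine ⟨_, mul_mem (completion.func r c b e).2 (completion.grp r c b
    (Subgroup.inclusion (pointStabilizer_le W b) u)).2, fun φ => ?_, fun w hw φ => ?_⟩
  · change germ b 1 (e * formalAct W b _ φ) = formalAct (pointStabilizer W b) 0 u (germ b 1 φ)
    rw [map_mul, he, one_mul, germ_formalAct, one_mul, ← germ_inclusion_mul, mul_one]
  · change germ b w (e * formalAct W b _ φ) = 0
    rw [map_mul, he' w (notMem_range_inclusion_iff.1 hw), zero_mul]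

lemma localDunklOp_mem_corners (hc : IsInvariant c) (a : V) :
    localDunklOp r c b a ∈ (orbitGerms r c b).corners (completion r c b) := by
  obtain ⟨e, he, he'⟩ := exists_germ_supported (W := W) (b := b) 1
  obtain ⟨χ, hχ, hχ'⟩ := exists_germ_supported (W := W) (b := b)
    (∑ s ∈ farReflections W b, poleCoeff r c b s a)
  refine ⟨_, add_mem (mul_mem (completion.func r c b e).2 (mul_mem (completion.dunklOp r c b a).2
    (completion.func r c b e).2)) (completion.func r c b χ).2, fun φ => ?_, fun w hw φ => ?_⟩
  · change germ b 1 (e * (completion.dunklOp r c b a).1 (e * φ) + χ * φ) = _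
    rw [map_add, map_mul (germ b 1), map_mul (germ b 1) χ, he, one_mul, hχ,
      germ_dunklOp_mul_of_supported hc he he']
    rfl
  · change germ b w (e * (completion.dunklOp r c b a).1 (e * φ) + χ * φ) = 0
    rw [map_add, map_mul (germ b w), map_mul (germ b w) χ,
      he' w (notMem_range_inclusion_iff.1 hw), hχ' w (notMem_range_inclusion_iff.1 hw), zero_mul,
      zero_mul, add_zero]

lemma mem_corners (hc : IsInvariant c) (m : localCompletion r c b) :
    m ∈ (orbitGerms r c b).corners (completion r c b) := by
  have hone : (1 : localCompletion r c b) ∈ (orbitGerms r c b).corners (completion r c b) :=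
    func_one (b := (0 : V)) ▸ func_mem_corners 1
  exact completion_induction (S := NonUnitalSubalgebra.toSubalgebra _ hone) func_mem_corners
    localGrp_mem_corners (localDunklOp_mem_corners hc) m

variable (r b) in
/-- The homomorphism from the completion of `H_c(W, V)` at `b` to the centralizer algebra. -/
def thetaHom (hc : IsInvariant c) : completion r c b →ₐ[ℂ] localCentralizer r c b :=
  (orbitGerms r c b).centralizerHom.comp (Subalgebra.inclusion (completion_le_centralizing hc))

lemma bijective_thetaHom (hc : IsInvariant c) : Function.Bijective (thetaHom r b hc) :=
  GermSystem.bijective_centralizerHom_comp_inclusion (D := orbitGerms r c b)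
    (ρ := completion.grp r c b) (Subgroup.inclusion_injective (pointStabilizer_le W b))
    (fun u w φ => germ_formalAct u w φ) (mem_corners hc) (completion_le_centralizing hc)

variable (r b) in
/-- The isomorphism `θ` from the completion of `H_c(W, V)` at `b` to the centralizer algebra. -/
def theta (hc : IsInvariant c) : completion r c b ≃ₐ[ℂ] localCentralizer r c b :=
  AlgEquiv.ofBijective (thetaHom r b hc) (bijective_thetaHom hc)

variable (hc : IsInvariant c)
  (f : funH (Subgroup.inclusion (pointStabilizer_le W b)) (localGrp r c b)) (w : W)
include hc

lemma theta_apply_eq {T : completion r c b} {m : localCompletion r c b}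
    (h : ∀ ψ, m • ψ = germ b w (T.1 ((orbitGerms r c b).glue f ψ))) :
    (theta r b hc T f).1 w = m :=
  FaithfulSMul.eq_of_smul_eq_smul fun ψ : FormalFun (pointStabilizer W b) 0 =>
    ((GermSystem.intertwines_centralizerHom _).apply_smul f w ψ).trans (h ψ).symm

lemma theta_grp (u : W) : (theta r b hc (completion.grp r c b u) f).1 w = f.1 (w * u) :=
  theta_apply_eq hc f w fun ψ =>
    ((orbitGerms r c b).germ_glue f ψ (w * u)).symm.trans (germ_formalAct u w _).symm

lemma theta_func (φ : FormalFun W b) :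
    (theta r b hc (completion.func r c b φ) f).1 w =
      completion.func _ _ 0 (germ b w φ) * f.1 w :=
  theta_apply_eq hc f w fun ψ =>
    (congrArg (germ b w φ * ·) ((orbitGerms r c b).germ_glue f ψ w)).symm.trans
      (map_mul (germ b w) φ _).symm

lemma theta_lin (α : Dual ℂ V) :
    (theta r b hc (completion.func r c b (formalLin W b α)) f).1 w =
      (completion.func _ _ 0 (formalLin (pointStabilizer W b) 0 (dualAct (w : V ≃ₗ[ℂ] V) α)) +
        algebraMap ℂ _ (dualAct (w : V ≃ₗ[ℂ] V) α b)) * f.1 w := by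
  refine (theta_func hc f w _).trans (congrArg (· * f.1 w) ?_)
  rw [germ_formalLin, func_add_algebraMap]

lemma theta_dunklOp (a : V) :
    (theta r b hc (completion.dunklOp r c b a) f).1 w = dunklFamily r c b a f.1 w :=
  theta_apply_eq hc f w fun ψ => dunklFamily_smul hc ((orbitGerms r c b).germ_glue f ψ) w

omit f w

lemma existsUnique_theta [FiniteDimensional ℂ V] :
    ∃! θ : completion r c b ≃ₐ[ℂ] localCentralizer r c b,
      (∀ u f (w : W), (θ (completion.grp r c b u) f).1 w = f.1 (w * u)) ∧
      (∀ α f (w : W), (θ (completion.func r c b (formalLin W b α)) f).1 w =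
        (completion.func _ _ 0 (formalLin (pointStabilizer W b) 0 (dualAct w.1 α)) +
          algebraMap ℂ _ (dualAct w.1 α b)) * f.1 w) ∧
      ∀ a f (w : W), (θ (completion.dunklOp r c b a) f).1 w = dunklFamily r c b a f.1 w := by
  have ext {S S' : localCentralizer r c b} (h : ∀ f w, (S f).1 w = (S' f).1 w) : S = S' :=
    LinearMap.ext fun f => Subtype.ext (funext (h f))
  refine ⟨theta r b hc, ⟨fun u f w => theta_grp hc f w u, fun α f w => theta_lin hc f w α,
    fun a f w => theta_dunklOp hc f w a⟩, ?_⟩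
  rintro θ ⟨hgrp, hx, hdunkl⟩
  exact algEquiv_ext_of_generators
    (fun u => ext fun f w => (hgrp u f w).trans (theta_grp hc f w u).symm)
    (fun α => ext fun f w => (hx α f w).trans (theta_lin hc f w α).symm)
    fun a => ext fun f w => (hdunkl a f w).trans (theta_dunklOp hc f w a).symm

end Theta

end

end Cherednik

theorem mainTheorem1 {V : Type*} [AddCommGroup V] [Module ℂ V] [FiniteDimensional ℂ V]
    (W : Subgroup (V ≃ₗ[ℂ] V)) [Finite W] (r : Cherednik.Roots W)
    (c : Cherednik.reflections W → ℂ) (hc : Cherednik.IsInvariant c) (b : V) :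
    ∃ (ι : Cherednik.Alg r c →ₐ[ℂ] Cherednik.completion r c b)
      (ι' : Cherednik.Alg (r.restrict (Cherednik.pointStabilizer_le W b))
          (Cherednik.restrictParam (Cherednik.pointStabilizer_le W b) c) →ₐ[ℂ]
        Cherednik.localCompletion r c b),
      Cherednik.IsNatural r c b ι ∧ Cherednik.IsNatural _ _ 0 ι' ∧
      ∃! θ : Cherednik.completion r c b ≃ₐ[ℂ] Cherednik.localCentralizer r c b,
        (∀ u f (w : W), (θ (ι (Cherednik.Alg.grp r c u)) f).1 w = f.1 (w * u)) ∧
        (∀ α f (w : W), (θ (ι (Cherednik.Alg.x r c α)) f).1 w =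
          (ι' (Cherednik.Alg.x _ _ (Cherednik.dualAct w.1 α)) +
            algebraMap ℂ _ (Cherednik.dualAct w.1 α b)) * f.1 w) ∧
        (∀ a f (w : W), (θ (ι (Cherednik.Alg.y r c a)) f).1 w =
          ι' (Cherednik.Alg.y _ _ (w.1 a)) * f.1 w +
            ∑ᶠ (s : Cherednik.reflections W) (_ : s.1 ∉ Cherednik.pointStabilizer W b),
              (2 * c s / (1 - r.eig s)) •
                (Cherednik.completion.func _ _ 0
                    (r.root s (w.1 a) • Cherednik.invShifted W b (r.root s)) *
                  (f.1 (⟨s.1, s.2.1⟩ * w) - f.1 w))) := by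
  have hc' := hc.restrictParam (Cherednik.pointStabilizer_le W b)
  have hι := Cherednik.isNatural_naturalHom (r := r) (b := b) hc
  have hι' := Cherednik.isNatural_naturalHom
    (r := r.restrict (Cherednik.pointStabilizer_le W b)) (b := 0) hc'
  refine ⟨Cherednik.naturalHom r b hc, Cherednik.naturalHom _ 0 hc', hι, hι', ?_⟩
  simp only [hι.1, hι.2.1, hι.2.2, hι'.2.1, hι'.2.2]
  exact Cherednik.existsUnique_theta hc
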